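/- **Infinitesimal Rigid Displacement Lemma.** Let $\Omega\subset\mathbb R^3$ be a Lipschitz domain, that is, a nonempty connected open set such that every point of $\partial\Omega$ has an open neighbourhood $U$ and a bijective bi-Lipschitz map $\varphi:(-1,1)^3\to U$ which maps $(-1,1)^2\times(0,1)$ onto $U\cap\Omega$ and $(-1,1)^2\times\{0\}$ onto $U\cap\partial\Omega$. Let $p,q\in(1,\infty)$ with $1/p+1/q=1$, let $\Phi\in W^{1,p}(\Omega;\mathbb R^3)$ and $\Psi\in W^{1,\infty}(\Omega;\mathbb R^3)\cap W^{2,q}(\Omega;\mathbb R^3)$, and let $\nabla\Phi,\nabla\Psi$ denote their (weak) Jacobian matrices, $(\nabla\Phi)_{ij}=\partial_j\Phi_i$. Suppose that there is a constant $c^+>0$ with $\det\nabla\Psi\ge c^+$ a.e. in $\Omega$, and that $$\operatorname{sym}(\nabla\Phi^\top\nabla\Psi)=0\quad\text{a.e. in }\Omega,\qquad\text{where }\operatorname{sym}M:=\tfrac12(M+M^\top).$$ Then there exist a constant skew-symmetric matrix $A\in\mathfrak{so}(3)$ and a constant vector $a\in\mathbb R^3$ such that $\Phi=A\Psi+a$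 a.e. in $\Omega$. -/

import Mathlib

open MeasureTheory Set
open scoped ContDiff Matrix

/-- `v` is the weak partial derivative `∂ⱼ u` in the open set `Ω ⊆ ℝⁿ`: both functions are locally
integrable in `Ω`, and `∫_Ω u ∂ⱼφ = - ∫_Ω v φ` for every test function `φ ∈ C_c^∞(Ω)`. -/
def HasWeakPartial {n : ℕ} (Ω : Set (EuclideanSpace ℝ (Fin n))) (j : Fin n)
    (u v : EuclideanSpace ℝ (Fin n) → ℝ) : Prop :=
  LocallyIntegrableOn u Ω volume ∧ LocallyIntegrableOn v Ω volume ∧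
    ∀ φ : EuclideanSpace ℝ (Fin n) → ℝ, ContDiff ℝ ∞ φ → HasCompactSupport φ → tsupport φ ⊆ Ω →
      ∫ x in Ω, u x * fderiv ℝ φ x (EuclideanSpace.single j 1) = - ∫ x in Ω, v x * φ x

/-- The Sobolev space `W^{k,p}(Ω)` of real functions on the open set `Ω ⊆ ℝⁿ`: all weak
derivatives of order at most `k` exist and lie in `L^p(Ω)`. -/
def MemSobolev {n : ℕ} (Ω : Set (EuclideanSpace ℝ (Fin n))) (p : ENNReal) :
    ℕ → (EuclideanSpace ℝ (Fin n) → ℝ) → Prop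
  | 0, u => MemLp u p (volume.restrict Ω)
  | k + 1, u => MemLp u p (volume.restrict Ω) ∧
      ∀ j : Fin n, ∃ v : EuclideanSpace ℝ (Fin n) → ℝ,
        HasWeakPartial Ω j u v ∧ MemSobolev Ω p k v

/-- The Sobolev space `W^{k,p}(Ω; ℝᵐ)` of vector fields, componentwise. -/
def MemSobolevVec {n m : ℕ} (Ω : Set (EuclideanSpace ℝ (Fin n))) (p : ENNReal) (k : ℕ)
    (u : EuclideanSpace ℝ (Fin n) → EuclideanSpace ℝ (Fin m)) : Prop :=
  ∀ i : Fin m, MemSobolev Ω p k (fun x => u x i)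

/-- `G` is (a representative of) the weak Jacobian `∇u` of the vector field `u` in `Ω`,
i.e. `G i j = ∂ⱼ uᵢ`; the rows of `∇u` are the gradients of the components of `u`. -/
def IsWeakJacobian {n m : ℕ} (Ω : Set (EuclideanSpace ℝ (Fin n)))
    (u : EuclideanSpace ℝ (Fin n) → EuclideanSpace ℝ (Fin m))
    (G : EuclideanSpace ℝ (Fin n) → Matrix (Fin m) (Fin n) ℝ) : Prop :=
  ∀ (i : Fin m) (j : Fin n), HasWeakPartial Ω j (fun x => u x i) (fun x => G x i j)

/-- The symmetric part `sym M = (M + Mᵀ) / 2` of a square matrix. -/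
noncomputable def symPart {n : ℕ} (M : Matrix (Fin n) (Fin n) ℝ) : Matrix (Fin n) (Fin n) ℝ :=
  (1 / 2 : ℝ) • (M + Mᵀ)

/-- The open cube `(-1,1)³`. -/
def openCube : Set (EuclideanSpace ℝ (Fin 3)) := {y | ∀ i, |y i| < 1}

/-- A Lipschitz domain in `ℝ³`: a nonempty connected open set such that every boundary point has
an open neighbourhood `U` and a bi-Lipschitz bijection `φ : (-1,1)³ → U` mapping
`(-1,1)² × (0,1)` onto `U ∩ Ω` and `(-1,1)² × {0}` onto `U ∩ ∂Ω`. -/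
def IsLipschitzDomain (Ω : Set (EuclideanSpace ℝ (Fin 3))) : Prop :=
  IsOpen Ω ∧ IsConnected Ω ∧
    ∀ x ∈ frontier Ω, ∃ (U : Set (EuclideanSpace ℝ (Fin 3)))
      (φ : EuclideanSpace ℝ (Fin 3) → EuclideanSpace ℝ (Fin 3)) (L : ℝ),
      IsOpen U ∧ x ∈ U ∧
      (∀ y ∈ openCube, ∀ z ∈ openCube,
        dist (φ y) (φ z) ≤ L * dist y z ∧ dist y z ≤ L * dist (φ y) (φ z)) ∧
      φ '' openCube = U ∧
      φ '' {y ∈ openCube | 0 < y 2} = U ∩ Ω ∧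
      φ '' {y ∈ openCube | y 2 = 0} = U ∩ frontier Ω

/-! Put `B = ∇Φ (∇Ψ)⁻¹`, which is skew by the symmetry hypothesis, and let `Gᵣ` be the columns of
`G = (∇Ψ)⁻¹`. As vector fields these commute, being the pullbacks of the coordinate fields under
`Ψ`, and `B i r = GᵣΦᵢ`. For a coefficient `φ` with compact support in `Ω`, two integrations by
parts therefore give `∫ B i r div (φ Gₘ) = ∫ B i m div (φ Gᵣ)`. An array `t i r m` which is
symmetric in `r, m` and skew in `i, r` vanishes, so all these integrals are zero. Replacing `φ` by
`φ ∂ₛΨₘ` and summing over `m` turns `div (φ Gₘ)` into `∂ₛφ`; hence `∇B = 0`, `B` is a constant skew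
matrix `A`, and `∇(Φ - AΨ) = 0`. The chain rule is available for `G` because `∇Ψ` is bounded with
derivatives in `L^q`, and the integrations by parts are justified by mollification and the
duality of `L^p` and `L^q`. -/

open Filter Topology Convolution

section Convergence

variable {X : Type*} [MeasurableSpace X] {μ : Measure X} {f g : X → ℝ} {F G : ℕ → X → ℝ} {C : ℝ}

lemma eventually_integrable_of_tendsto_lintegral_enorm_sub (hf : Integrable f μ)
    (hF : ∀ k, AEStronglyMeasurable (F k) μ)
    (hlim : Tendsto (fun k => ∫⁻ x, ‖F k x - f x‖ₑ ∂μ) atTop (𝓝 0)) :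
    ∀ᶠ k in atTop, Integrable (F k) μ := by
  filter_upwards [hlim.eventually (gt_mem_nhds ENNReal.zero_lt_top)] with k hk
  have hsub : Integrable (fun x => F k x - f x) μ := ⟨(hF k).sub hf.1, hk⟩
  exact (hsub.add hf).congr (Eventually.of_forall fun x => sub_add_cancel _ _)

lemma tendsto_integral_mul_of_tendsto_ae_of_tendsto_lintegral_enorm_sub (hf : Integrable f μ)
    (hF : ∀ k, AEStronglyMeasurable (F k) μ)
    (hFf : Tendsto (fun k => ∫⁻ x, ‖F k x - f x‖ₑ ∂μ) atTop (𝓝 0))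
    (hG : ∀ k, AEStronglyMeasurable (G k) μ) (hC : ∀ k, ∀ᵐ x ∂μ, ‖G k x‖ ≤ C)
    (hGg : ∀ᵐ x ∂μ, Tendsto (fun k => G k x) atTop (𝓝 (g x))) :
    Tendsto (fun k => ∫ x, G k x * F k x ∂μ) atTop (𝓝 (∫ x, g x * f x ∂μ)) := by
  have hfixed : Tendsto (fun k => ∫ x, G k x * f x ∂μ) atTop (𝓝 (∫ x, g x * f x ∂μ)) := by
    refine tendsto_integral_of_dominated_convergence (fun x => C * ‖f x‖)
      (fun k => (hG k).mul hf.1) (hf.norm.const_mul C) (fun k => ?_) ?_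
    · filter_upwards [hC k] with x hx
      rw [norm_mul]
      gcongr
    · filter_upwards [hGg] with x hx using hx.mul_const _
  have herror : Tendsto (fun k => ∫ x, G k x * (F k x - f x) ∂μ) atTop (𝓝 0) := by
    have hbound : Tendsto (fun k => ENNReal.ofReal C * ∫⁻ x, ‖F k x - f x‖ₑ ∂μ) atTop (𝓝 0) := by
      simpa using ENNReal.Tendsto.const_mul hFf (Or.inr (ENNReal.ofReal_ne_top (r := C)))
    rw [tendsto_iff_edist_tendsto_0]
    simp_rw [edist_zero_right]
    refine tendsto_of_tendsto_of_tendsto_of_le_of_le tendsto_const_nhds hbound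
      (fun _ => zero_le) fun k => (enorm_integral_le_lintegral_enorm _).trans ?_
    rw [← lintegral_const_mul' _ _ ENNReal.ofReal_ne_top]
    refine lintegral_mono_ae ?_
    filter_upwards [hC k] with x hx
    rw [enorm_mul, ← ofReal_norm (G k x)]
    gcongr
  refine (add_zero (∫ x, g x * f x ∂μ) ▸ hfixed.add herror).congr' ?_
  filter_upwards [eventually_integrable_of_tendsto_lintegral_enorm_sub hf hF hFf] with k hk
  have hdiff : Integrable (fun x => G k x * (F k x - f x)) μ :=
    (hk.sub hf).bdd_mul (hG k) (hC k)
  rw [← integral_add (hf.bdd_mul (hG k) (hC k)) hdiff]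
  congr with x
  ring

end Convergence

/-- A bump function at the origin of outer radius `2 / (k + 1)`, the profile of the `k`-th
mollifier. -/
noncomputable def shrinkingBump (E : Type*) [NormedAddCommGroup E] (k : ℕ) :
    ContDiffBump (0 : E) where
  rIn := 1 / (k + 1)
  rOut := 2 / (k + 1)
  rIn_pos := by positivity
  rIn_lt_rOut := by gcongr; norm_num

lemma tendsto_shrinkingBump_rOut {E : Type*} [NormedAddCommGroup E] :
    Tendsto (fun k => (shrinkingBump E k).rOut) atTop (𝓝 0) := by
  have := (tendsto_one_div_add_atTop_nhds_zero_nat (𝕜 := ℝ)).const_mul 2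
  simpa [shrinkingBump, div_eq_mul_inv] using this

lemma eventually_closedBall_shrinkingBump_subset {E : Type*} [NormedAddCommGroup E]
    {K Ω : Set E} (hK : IsCompact K) (hΩ : IsOpen Ω) (hKΩ : K ⊆ Ω) :
    ∀ᶠ k in atTop, ∀ x ∈ K, Metric.closedBall x (shrinkingBump E k).rOut ⊆ Ω := by
  obtain ⟨δ, hδ, hsub⟩ := hK.exists_cthickening_subset_open hΩ hKΩ
  filter_upwards [(tendsto_shrinkingBump_rOut (E := E)).eventually (gt_mem_nhds hδ)] with k hk x hx
  exact (Metric.closedBall_subset_closedBall hk.le).trans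
    ((Metric.closedBall_subset_cthickening hx δ).trans hsub)

section Mollification

variable {E : Type*} [NormedAddCommGroup E] [InnerProductSpace ℝ E] [FiniteDimensional ℝ E]
  [MeasurableSpace E] [BorelSpace E] {f v w : E → ℝ} {p q : ENNReal}

/-- The `k`-th standard mollifier: a smooth nonnegative kernel of integral one supported in the
closed ball of radius `2 / (k + 1)`. -/
noncomputable def mollifier (k : ℕ) : E → ℝ := (shrinkingBump E k).normed volume

/-- The mollification of a function at scale `2 / (k + 1)`, by which weak derivatives are
approximated. -/
noncomputable def mollify (k : ℕ) (f : E → ℝ) (x : E) : ℝ := ∫ y, mollifier k (x - y) * f y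

lemma contDiff_mollifier (k : ℕ) : ContDiff ℝ ∞ (mollifier k : E → ℝ) :=
  ContDiffBump.contDiff_normed _

lemma continuous_mollifier (k : ℕ) : Continuous (mollifier k : E → ℝ) :=
  (contDiff_mollifier k).continuous

lemma hasCompactSupport_mollifier (k : ℕ) : HasCompactSupport (mollifier k : E → ℝ) :=
  ContDiffBump.hasCompactSupport_normed _

lemma mollifier_nonneg (k : ℕ) (x : E) : 0 ≤ mollifier k x :=
  ContDiffBump.nonneg_normed _ _

lemma integral_mollifier (k : ℕ) : ∫ x : E, mollifier k x = 1 :=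
  ContDiffBump.integral_normed _

lemma integrable_mollifier (k : ℕ) : Integrable (mollifier k : E → ℝ) :=
  ContDiffBump.integrable_normed _

lemma tsupport_mollifier (k : ℕ) :
    tsupport (mollifier k : E → ℝ) = Metric.closedBall 0 (shrinkingBump E k).rOut :=
  ContDiffBump.tsupport_normed_eq _

lemma mollify_eq_convolution_left (k : ℕ) (f : E → ℝ) :
    mollify k f = mollifier k ⋆[ContinuousLinearMap.lsmul ℝ ℝ, volume] f := by
  ext x
  rw [convolution_lsmul_swap]
  rfl

lemma mollify_eq_convolution_right (k : ℕ) (f : E → ℝ) :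
    mollify k f = f ⋆[ContinuousLinearMap.mul ℝ ℝ, volume] mollifier k := by
  ext x
  rw [convolution_def]
  simp [mollify, mul_comm]

lemma mollify_apply (k : ℕ) (f : E → ℝ) (x : E) :
    mollify k f x = ∫ y, mollifier k y * f (x - y) := by
  rw [mollify_eq_convolution_left, convolution_def]
  rfl

lemma contDiff_mollify (k : ℕ) (hf : LocallyIntegrable f) : ContDiff ℝ ∞ (mollify k f) := by
  rw [mollify_eq_convolution_right]
  exact (hasCompactSupport_mollifier k).contDiff_convolution_right _ hf (contDiff_mollifier k)

lemma fderiv_mollify_apply (k : ℕ) (hf : LocallyIntegrable f) (x e : E) :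
    fderiv ℝ (mollify k f) x e = ∫ y, f y * fderiv ℝ (mollifier k) (x - y) e := by
  have h := (hasCompactSupport_mollifier k).hasFDerivAt_convolution_right
    (ContinuousLinearMap.mul ℝ ℝ) hf ((contDiff_mollifier k).of_le (by simp)) x
  rw [mollify_eq_convolution_right, h.fderiv, convolution_precompR_apply _ hf
    ((hasCompactSupport_mollifier k).fderiv ℝ)
    ((contDiff_mollifier k).continuous_fderiv (by simp))]
  rfl

lemma integrable_mollifier_mul (k : ℕ) (hf : LocallyIntegrable f) (x : E) :
    Integrable (fun y => mollifier k y * f (x - y)) :=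
  (hasCompactSupport_mollifier k).convolutionExists_left (ContinuousLinearMap.lsmul ℝ ℝ)
    (continuous_mollifier k) hf x

lemma norm_mollify_le (k : ℕ) {C : ℝ} (hf : ∀ᵐ x, ‖f x‖ ≤ C) (x : E) : ‖mollify k f x‖ ≤ C := by
  rw [mollify_apply]
  have hae : ∀ᵐ y : E, ‖f (x - y)‖ ≤ C :=
    (quasiMeasurePreserving_sub_left_of_right_invariant (volume : Measure E) x).ae hf
  calc ‖∫ y : E, mollifier k y * f (x - y)‖ ≤ ∫ y : E, mollifier k y * C := by
        refine norm_integral_le_of_norm_le ((integrable_mollifier k).mul_const C) ?_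
        filter_upwards [hae] with y hy
        rw [norm_mul, Real.norm_of_nonneg (mollifier_nonneg k y)]
        exact mul_le_mul_of_nonneg_left hy (mollifier_nonneg k y)
    _ = C := by rw [integral_mul_const, integral_mollifier, one_mul]

lemma ae_tendsto_mollify (hf : LocallyIntegrable f) :
    ∀ᵐ x, Tendsto (fun k => mollify k f x) atTop (𝓝 (f x)) := by
  simp_rw [mollify_eq_convolution_left]
  refine ContDiffBump.ae_convolution_tendsto_right_of_locallyIntegrable (K := 2)
    tendsto_shrinkingBump_rOut (Eventually.of_forall fun k => ?_) hf
  simp [shrinkingBump, div_eq_mul_inv]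

lemma lintegral_enorm_mollifier (k : ℕ) : ∫⁻ x : E, ‖(mollifier k x : ℝ)‖ₑ = 1 := by
  rw [← ofReal_integral_norm_eq_lintegral_enorm (integrable_mollifier k)]
  simp [Real.norm_of_nonneg (mollifier_nonneg k _), integral_mollifier]

lemma tendsto_lintegral_mollifier_mul {g : E → ENNReal} (hg : Tendsto g (𝓝 0) (𝓝 0)) :
    Tendsto (fun k => ∫⁻ y, ‖(mollifier k y : ℝ)‖ₑ * g y) atTop (𝓝 0) := by
  rw [ENNReal.tendsto_nhds_zero]
  intro ε hε
  obtain ⟨δ, hδ, hball⟩ := Metric.eventually_nhds_iff.1 (ENNReal.tendsto_nhds_zero.1 hg ε hε)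
  filter_upwards [tendsto_shrinkingBump_rOut (E := E) |>.eventually (gt_mem_nhds hδ)] with k hk
  calc ∫⁻ y, ‖(mollifier k y : ℝ)‖ₑ * g y ≤ ∫⁻ y : E, ‖(mollifier k y : ℝ)‖ₑ * ε := by
        refine lintegral_mono fun y => ?_
        by_cases hy : y ∈ tsupport (mollifier k : E → ℝ)
        · gcongr
          rw [tsupport_mollifier, Metric.mem_closedBall] at hy
          exact hball (hy.trans_lt hk)
        · simp [image_eq_zero_of_notMem_tsupport hy]
    _ = ε := by
        rw [lintegral_mul_const _ (continuous_mollifier k).measurable.enorm,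
          lintegral_enorm_mollifier, one_mul]

lemma tendsto_eLpNorm_translate_sub (hq : 1 ≤ q) (hq' : q ≠ ⊤) (hv : MemLp v q) :
    Tendsto (fun y => eLpNorm (fun x => v (x - y) - v x) q volume) (𝓝 0) (𝓝 0) := by
  have : Fact (1 ≤ q) := ⟨hq⟩
  have : Fact (q ≠ ⊤) := ⟨hq'⟩
  have hcont : Continuous fun y : E => DomAddAct.mk (-y) +ᵥ hv.toLp v :=
    (DomAddAct.continuous_mk.comp continuous_neg).vadd continuous_const
  refine (tendsto_iff_edist_tendsto_0.1 (hcont.tendsto 0)).congr fun y => ?_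
  rw [neg_zero, DomAddAct.mk_zero, zero_vadd, DomAddAct.mk_vadd_toLp, Lp.edist_toLp_toLp]
  refine eLpNorm_congr_ae (Eventually.of_forall fun x => ?_)
  simp [vadd_eq_add, sub_eq_neg_add]

lemma enorm_mollify_sub_le (k : ℕ) (hv : LocallyIntegrable v) (x : E) :
    ‖mollify k v x - v x‖ₑ ≤ ∫⁻ y, ‖(mollifier k y : ℝ)‖ₑ * ‖v (x - y) - v x‖ₑ := by
  have havg : mollify k v x - v x = ∫ y, mollifier k y * (v (x - y) - v x) := by
    simp_rw [mul_sub]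
    rw [integral_sub (integrable_mollifier_mul k hv x) ((integrable_mollifier k).mul_const _),
      integral_mul_const, integral_mollifier, one_mul, mollify_apply]
  rw [havg]
  simpa only [enorm_mul] using enorm_integral_le_lintegral_enorm
    fun y => mollifier k y * (v (x - y) - v x)

lemma lintegral_enorm_mul_le_eLpNorm_mul_eLpNorm [p.HolderConjugate q]
    (hw : AEStronglyMeasurable w) (hv : AEStronglyMeasurable v) :
    ∫⁻ x, ‖w x‖ₑ * ‖v x‖ₑ ≤ eLpNorm w p volume * eLpNorm v q volume := by
  simpa [eLpNorm_one_eq_lintegral_enorm, enorm_mul] using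
    eLpNorm_smul_le_mul_eLpNorm (p := p) (q := q) (r := 1) hv hw

lemma lintegral_mul_mollify_sub_le [p.HolderConjugate q] (k : ℕ)
    (hw : AEStronglyMeasurable w) (hv : LocallyIntegrable v) :
    ∫⁻ x, ‖w x‖ₑ * ‖mollify k v x - v x‖ₑ ≤ ∫⁻ y, ‖(mollifier k y : ℝ)‖ₑ *
      (eLpNorm w p volume * eLpNorm (fun x => v (x - y) - v x) q volume) := by
  have hvm := hv.aestronglyMeasurable
  have htranslate (y : E) : AEStronglyMeasurable fun x => v (x - y) - v x :=
    (hvm.comp_measurePreserving (measurePreserving_sub_right volume y)).sub hvm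
  have hjoint : AEStronglyMeasurable (fun z : E × E => v (z.1 - z.2) - v z.1)
      (volume.prod volume) :=
    (hvm.comp_quasiMeasurePreserving
      (quasiMeasurePreserving_sub_of_right_invariant volume volume)).sub hvm.comp_fst
  calc ∫⁻ x, ‖w x‖ₑ * ‖mollify k v x - v x‖ₑ
      ≤ ∫⁻ x, ∫⁻ y, ‖w x‖ₑ * (‖(mollifier k y : ℝ)‖ₑ * ‖v (x - y) - v x‖ₑ) := by
        refine lintegral_mono fun x => ?_
        rw [lintegral_const_mul' _ _ enorm_ne_top]
        gcongr
        exact enorm_mollify_sub_le k hv x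
    _ = ∫⁻ y, ∫⁻ x, ‖w x‖ₑ * (‖(mollifier k y : ℝ)‖ₑ * ‖v (x - y) - v x‖ₑ) :=
        lintegral_lintegral_swap (hw.enorm.comp_fst.mul
          (((continuous_mollifier k).measurable.enorm.comp measurable_snd).aemeasurable.mul
            hjoint.enorm))
    _ = ∫⁻ y, ‖(mollifier k y : ℝ)‖ₑ * ∫⁻ x, ‖w x‖ₑ * ‖v (x - y) - v x‖ₑ := by
        refine lintegral_congr fun y => ?_
        rw [← lintegral_const_mul' _ _ enorm_ne_top]
        exact lintegral_congr fun x => mul_left_comm _ _ _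
    _ ≤ _ := by
        gcongr with y
        exact lintegral_enorm_mul_le_eLpNorm_mul_eLpNorm hw (htranslate y)

lemma tendsto_lintegral_mul_mollify_sub_top (hw : Integrable w) (hv : MemLp v ⊤) :
    Tendsto (fun k => ∫⁻ x, ‖w x‖ₑ * ‖mollify k v x - v x‖ₑ) atTop (𝓝 0) := by
  set C := lpNorm v ⊤ volume
  have hC : ∀ᵐ x, ‖v x‖ ≤ C := ae_le_lpNorm_exponent_top hv
  have hvloc : LocallyIntegrable v := hv.locallyIntegrable le_top
  have hlim := tendsto_lintegral_of_dominated_convergence' (μ := volume)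
    (F := fun k x => ‖w x‖ₑ * ‖mollify k v x - v x‖ₑ) (f := fun _ => 0)
    (fun x => ‖w x‖ₑ * ENNReal.ofReal (C + C)) (fun k => hw.1.enorm.mul
      ((contDiff_mollify k hvloc).continuous.aestronglyMeasurable.sub hv.1).enorm)
    (fun k => ?_) ?_ ?_
  · simpa using hlim
  · filter_upwards [hC] with x hx
    rw [← ofReal_norm (mollify k v x - v x)]
    gcongr
    exact (norm_sub_le _ _).trans (add_le_add (norm_mollify_le k hC x) hx)
  · rw [lintegral_mul_const' _ _ ENNReal.ofReal_ne_top]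
    exact ENNReal.mul_ne_top hw.2.ne ENNReal.ofReal_ne_top
  · filter_upwards [ae_tendsto_mollify hvloc] with x hx
    simpa using ENNReal.Tendsto.const_mul (hx.sub_const (v x)).enorm (Or.inr enorm_ne_top)

lemma tendsto_lintegral_mul_mollify_sub [p.HolderConjugate q] (hw : MemLp w p) (hv : MemLp v q) :
    Tendsto (fun k => ∫⁻ x, ‖w x‖ₑ * ‖mollify k v x - v x‖ₑ) atTop (𝓝 0) := by
  have hq : 1 ≤ q := ENNReal.HolderConjugate.one_le q p
  rcases eq_or_ne q ⊤ with rfl | hq'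
  · obtain rfl : p = 1 := (ENNReal.HolderConjugate.eq_top_iff_eq_one ⊤ p).1 rfl
    exact tendsto_lintegral_mul_mollify_sub_top (memLp_one_iff_integrable.1 hw) hv
  · have hmodulus := ENNReal.Tendsto.const_mul (tendsto_eLpNorm_translate_sub hq hq' hv)
      (Or.inr hw.2.ne)
    rw [mul_zero] at hmodulus
    exact tendsto_of_tendsto_of_tendsto_of_le_of_le tendsto_const_nhds
      (tendsto_lintegral_mollifier_mul hmodulus) (fun _ => zero_le)
      fun k => lintegral_mul_mollify_sub_le k hw.1 (hv.locallyIntegrable hq)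

lemma tendsto_integral_mul_mollify [p.HolderConjugate q] (hw : MemLp w p) (hv : MemLp v q) :
    Tendsto (fun k => ∫ x, w x * mollify k v x) atTop (𝓝 (∫ x, w x * v x)) := by
  have hvloc : LocallyIntegrable v := hv.locallyIntegrable (ENNReal.HolderConjugate.one_le q p)
  have hL1 : Tendsto (fun k => ∫⁻ x, ‖w x * mollify k v x - w x * v x‖ₑ) atTop (𝓝 0) := by
    simpa only [← mul_sub, enorm_mul] using tendsto_lintegral_mul_mollify_sub hw hv
  have hint : Integrable (fun x => w x * v x) := hw.integrable_mul hv
  exact tendsto_integral_of_L1 _ hint.1 (eventually_integrable_of_tendsto_lintegral_enorm_sub hint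
    (fun k => hw.1.mul (contDiff_mollify k hvloc).continuous.aestronglyMeasurable) hL1) hL1

end Mollification

section TestIntegral

variable {E : Type*} [NormedAddCommGroup E] [MeasurableSpace E] {μ : Measure E} {Ω : Set E}
  {f g : E → ℝ}

lemma integrableOn_mul_of_tsupport_subset [BorelSpace E] (hf : LocallyIntegrableOn f Ω μ)
    (hg : Continuous g) (hgc : HasCompactSupport g) (hgΩ : tsupport g ⊆ Ω) :
    IntegrableOn (fun x => f x * g x) Ω μ := by
  have h : IntegrableOn (fun x => f x * g x) (tsupport g) μ :=
    (hf.integrableOn_compact_subset hgΩ hgc).mul_continuousOn hg.continuousOn hgc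
  refine ((integrableOn_iff_integrable_of_support_subset fun x hx => ?_).1 h).integrableOn
  exact subset_tsupport g (right_ne_zero_of_mul hx)

lemma setIntegral_mul_of_tsupport_subset (hgΩ : tsupport g ⊆ Ω) :
    ∫ x in Ω, f x * g x ∂μ = ∫ x, f x * g x ∂μ :=
  setIntegral_eq_integral_of_forall_compl_eq_zero fun x hx => by
    rw [image_eq_zero_of_notMem_tsupport fun h => hx (hgΩ h), mul_zero]

end TestIntegral

section LocallyConstant

variable {X β : Type*} [TopologicalSpace X] [MeasurableSpace X] {μ : Measure X} {Ω : Set X}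
  {f : X → β}

lemma neBot_nhds_inf_ae [μ.IsOpenPosMeasure] (x : X) : (𝓝 x ⊓ ae μ).NeBot :=
  inf_neBot_iff.2 fun {U} hU {V} hV => by
    rw [inter_comm]
    exact (Measure.dense_of_ae hV).inter_nhds_nonempty hU

lemma ae_restrict_of_forall_eventually_nhds_inf_ae [SecondCountableTopology X]
    [OpensMeasurableSpace X] (hΩ : IsOpen Ω) {P : X → Prop}
    (h : ∀ x ∈ Ω, ∀ᶠ y in 𝓝 x ⊓ ae μ, P y) : ∀ᵐ x ∂μ.restrict Ω, P x := by
  rw [ae_restrict_iff' hΩ.measurableSet]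
  refine measure_null_of_locally_null _ fun x hx => ?_
  obtain ⟨hxΩ, -⟩ := Classical.not_imp.1 hx
  obtain ⟨U, hU, V, hV, hUV⟩ := eventually_inf.1 (h x hxΩ)
  refine ⟨{y | y ∈ Ω → P y}ᶜ ∩ U, inter_mem self_mem_nhdsWithin (mem_nhdsWithin_of_mem_nhds hU),
    measure_mono_null (fun y hy hyV => hy.1 fun _ => hUV y ⟨hy.2, hyV⟩) hV⟩

lemma exists_ae_restrict_eq_const [μ.IsOpenPosMeasure] [SecondCountableTopology X]
    [OpensMeasurableSpace X] (hΩ : IsOpen Ω) (hconn : IsConnected Ω)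
    (h : ∀ x ∈ Ω, ∃ c, ∀ᶠ y in 𝓝 x ⊓ ae μ, f y = c) :
    ∃ c, ∀ᵐ x ∂μ.restrict Ω, f x = c := by
  obtain ⟨x₀, hx₀⟩ := hconn.nonempty
  have : Nonempty β := ⟨f x₀⟩
  choose! c hc using h
  have hlocal : ∀ x ∈ Ω, ∀ᶠ y in 𝓝 x, y ∈ Ω → c x = c y := fun x hx => by
    obtain ⟨U, hU, V, hV, hUV⟩ := eventually_inf.1 (hc x hx)
    filter_upwards [eventually_mem_nhds_iff.2 hU] with y hy hyΩ
    have := neBot_nhds_inf_ae (μ := μ) y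
    have hfy : ∀ᶠ z in 𝓝 y ⊓ ae μ, f z = c x := eventually_inf.2 ⟨U, hy, V, hV, hUV⟩
    obtain ⟨z, hzx, hzy⟩ := (hfy.and (hc y hyΩ)).exists
    exact hzx.symm.trans hzy
  have hconst : ∀ x ∈ Ω, c x = c x₀ := fun x hx =>
    hconn.isPreconnected.induction₂ (fun x y => c x = c y)
      (fun x hx => eventually_nhdsWithin_iff.2 (hlocal x hx))
      (fun _ _ _ _ _ _ => Eq.trans) (fun _ _ _ _ => Eq.symm) hx hx₀
  exact ⟨c x₀, ae_restrict_of_forall_eventually_nhds_inf_ae hΩ fun x hx =>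
    hconst x hx ▸ hc x hx⟩

end LocallyConstant

section WeakDerivative

variable {n : ℕ} {Ω : Set (EuclideanSpace ℝ (Fin n))} {j k : Fin n}
  {u v w : EuclideanSpace ℝ (Fin n) → ℝ}

lemma continuous_fderiv_apply_single {φ : EuclideanSpace ℝ (Fin n) → ℝ} (hφ : ContDiff ℝ 1 φ)
    (j : Fin n) : Continuous fun x => fderiv ℝ φ x (EuclideanSpace.single j 1) :=
  (hφ.continuous_fderiv one_ne_zero).clm_apply continuous_const

namespace HasWeakPartial

lemma ae_unique (hΩ : IsOpen Ω) (hv : HasWeakPartial Ω j u v) (hw : HasWeakPartial Ω j u w) :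
    v =ᵐ[volume.restrict Ω] w := by
  have hzero := hΩ.ae_eq_zero_of_integral_contDiff_smul_eq_zero (f := fun x => v x - w x)
    (μ := volume) (hv.2.1.sub hw.2.1) fun φ hφ hφc hφΩ => ?_
  · filter_upwards [(ae_restrict_iff' hΩ.measurableSet).2 hzero] with x hx
    exact sub_eq_zero.1 hx
  · have htest : ∫ x in Ω, v x * φ x = ∫ x in Ω, w x * φ x :=
      neg_injective ((hv.2.2 φ hφ hφc hφΩ).symm.trans (hw.2.2 φ hφ hφc hφΩ))
    simp_rw [smul_eq_mul, mul_comm (φ _)]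
    rw [← setIntegral_mul_of_tsupport_subset hφΩ]
    simp_rw [sub_mul]
    rw [integral_sub (integrableOn_mul_of_tsupport_subset hv.2.1 hφ.continuous hφc hφΩ)
      (integrableOn_mul_of_tsupport_subset hw.2.1 hφ.continuous hφc hφΩ), htest, sub_self]

lemma congr {u' v' : EuclideanSpace ℝ (Fin n) → ℝ} (h : HasWeakPartial Ω j u v)
    (hu : u =ᵐ[volume.restrict Ω] u') (hv : v =ᵐ[volume.restrict Ω] v') :
    HasWeakPartial Ω j u' v' := by
  refine ⟨h.1.congr hu, h.2.1.congr hv, fun φ hφ hφc hφΩ => ?_⟩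
  have hu' := hu.mul (ae_eq_refl fun x => fderiv ℝ φ x (EuclideanSpace.single j 1))
  exact (integral_congr_ae hu').symm.trans
    ((h.2.2 φ hφ hφc hφΩ).trans (congr_arg _ (integral_congr_ae (hv.mul (ae_eq_refl φ)))))

lemma mono {Ω' : Set (EuclideanSpace ℝ (Fin n))} (h : HasWeakPartial Ω j u v) (hs : Ω' ⊆ Ω) :
    HasWeakPartial Ω' j u v := by
  refine ⟨h.1.mono_set hs, h.2.1.mono_set hs, fun φ hφ hφc hφΩ => ?_⟩
  have hdφ := tsupport_fderiv_apply_subset ℝ (f := φ) (EuclideanSpace.single j 1)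
  have htest := h.2.2 φ hφ hφc (hφΩ.trans hs)
  rw [setIntegral_mul_of_tsupport_subset ((hdφ.trans hφΩ).trans hs),
    setIntegral_mul_of_tsupport_subset (hφΩ.trans hs)] at htest
  rwa [setIntegral_mul_of_tsupport_subset (hdφ.trans hφΩ), setIntegral_mul_of_tsupport_subset hφΩ]

lemma add {u' v' : EuclideanSpace ℝ (Fin n) → ℝ} (h : HasWeakPartial Ω j u v)
    (h' : HasWeakPartial Ω j u' v') :
    HasWeakPartial Ω j (fun x => u x + u' x) (fun x => v x + v' x) := by
  refine ⟨h.1.add h'.1, h.2.1.add h'.2.1, fun φ hφ hφc hφΩ => ?_⟩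
  have hdφ := continuous_fderiv_apply_single (hφ.of_le (by simp)) j
  have hdφc := hφc.fderiv_apply ℝ (EuclideanSpace.single j 1)
  have hdφΩ := (tsupport_fderiv_apply_subset ℝ (f := φ) (EuclideanSpace.single j 1)).trans hφΩ
  simp_rw [add_mul]
  rw [integral_add (integrableOn_mul_of_tsupport_subset h.1 hdφ hdφc hdφΩ)
    (integrableOn_mul_of_tsupport_subset h'.1 hdφ hdφc hdφΩ),
    integral_add (integrableOn_mul_of_tsupport_subset h.2.1 hφ.continuous hφc hφΩ)
    (integrableOn_mul_of_tsupport_subset h'.2.1 hφ.continuous hφc hφΩ),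
    h.2.2 φ hφ hφc hφΩ, h'.2.2 φ hφ hφc hφΩ, neg_add]

lemma const_mul (h : HasWeakPartial Ω j u v) (c : ℝ) :
    HasWeakPartial Ω j (fun x => c * u x) (fun x => c * v x) := by
  refine ⟨h.1.smul c, h.2.1.smul c, fun φ hφ hφc hφΩ => ?_⟩
  simp_rw [mul_assoc]
  rw [integral_const_mul, integral_const_mul, h.2.2 φ hφ hφc hφΩ, mul_neg]

lemma of_contDiff (hu : ContDiff ℝ 1 u) (Ω : Set (EuclideanSpace ℝ (Fin n))) (j : Fin n) :
    HasWeakPartial Ω j u (fun x => fderiv ℝ u x (EuclideanSpace.single j 1)) := by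
  have hdu := continuous_fderiv_apply_single hu j
  refine ⟨hu.continuous.locallyIntegrable.locallyIntegrableOn _,
    hdu.locallyIntegrable.locallyIntegrableOn _, fun φ hφ hφc hφΩ => ?_⟩
  have hdφ := continuous_fderiv_apply_single (hφ.of_le (by simp)) j
  have hdφΩ := (tsupport_fderiv_apply_subset ℝ (f := φ) (EuclideanSpace.single j 1)).trans hφΩ
  rw [setIntegral_mul_of_tsupport_subset hdφΩ, setIntegral_mul_of_tsupport_subset hφΩ]
  exact integral_mul_fderiv_eq_neg_fderiv_mul_of_integrable
    ((hdu.mul hφ.continuous).integrable_of_hasCompactSupport hφc.mul_left)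
    ((hu.continuous.mul hdφ).integrable_of_hasCompactSupport (hφc.fderiv_apply ℝ _).mul_left)
    ((hu.continuous.mul hφ.continuous).integrable_of_hasCompactSupport hφc.mul_left)
    (fun x _ => hu.differentiable one_ne_zero x) (fun x _ => hφ.differentiable (by simp) x)

lemma const (c : ℝ) (Ω : Set (EuclideanSpace ℝ (Fin n))) (j : Fin n) :
    HasWeakPartial Ω j (fun _ => c) (fun _ => 0) := by
  simpa using of_contDiff (contDiff_const (c := c)) Ω j

lemma sum {ι : Type*} {u v : ι → EuclideanSpace ℝ (Fin n) → ℝ}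
    (h : ∀ i, HasWeakPartial Ω j (u i) (v i)) (s : Finset ι) :
    HasWeakPartial Ω j (fun x => ∑ i ∈ s, u i x) (fun x => ∑ i ∈ s, v i x) := by
  classical
  induction s using Finset.induction_on with
  | empty => simpa using const 0 Ω j
  | insert i s hi ih => simpa only [Finset.sum_insert hi] using (h i).add ih

lemma integral_mul_fderiv_comm (hv : HasWeakPartial Ω j u v) (hw : HasWeakPartial Ω k u w)
    {φ : EuclideanSpace ℝ (Fin n) → ℝ} (hφ : ContDiff ℝ ∞ φ) (hφc : HasCompactSupport φ)
    (hφΩ : tsupport φ ⊆ Ω) :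
    ∫ x in Ω, v x * fderiv ℝ φ x (EuclideanSpace.single k 1) =
      ∫ x in Ω, w x * fderiv ℝ φ x (EuclideanSpace.single j 1) := by
  have hdφ : ContDiff ℝ ∞ (fderiv ℝ φ) := hφ.fderiv_right (by simp)
  have hfderiv (e e' x) :
      fderiv ℝ (fun y => fderiv ℝ φ y e) x e' = fderiv ℝ (fderiv ℝ φ) x e' e := by
    rw [fderiv_clm_apply (hdφ.differentiable (by simp) x) (differentiableAt_const _)]
    simp
  have hsymm (x e e') : fderiv ℝ (fderiv ℝ φ) x e' e = fderiv ℝ (fderiv ℝ φ) x e e' :=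
    (hφ.contDiffAt.isSymmSndFDerivAt (by
      rw [minSmoothness_of_isRCLikeNormedField]
      exact WithTop.coe_le_coe.2 (le_top : (2 : ℕ∞) ≤ ⊤))).eq e' e
  have hjk := hv.2.2 _ (hdφ.clm_apply contDiff_const)
    (hφc.fderiv_apply ℝ (EuclideanSpace.single k 1))
    ((tsupport_fderiv_apply_subset ℝ (EuclideanSpace.single k 1)).trans hφΩ)
  have hkj := hw.2.2 _ (hdφ.clm_apply contDiff_const)
    (hφc.fderiv_apply ℝ (EuclideanSpace.single j 1))
    ((tsupport_fderiv_apply_subset ℝ (EuclideanSpace.single j 1)).trans hφΩ)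
  simp_rw [hfderiv] at hjk hkj
  simp_rw [hsymm _ (EuclideanSpace.single k 1)] at hjk
  rw [← neg_inj, ← hjk, ← hkj]

lemma swap {d : EuclideanSpace ℝ (Fin n) → ℝ} (hv : HasWeakPartial Ω j u v)
    (hw : HasWeakPartial Ω k u w) (hd : HasWeakPartial Ω k v d) : HasWeakPartial Ω j w d := by
  refine ⟨hw.2.1, hd.2.1, fun φ hφ hφc hφΩ => ?_⟩
  rw [← hv.integral_mul_fderiv_comm hw hφ hφc hφΩ, hd.2.2 φ hφ hφc hφΩ]

lemma fderiv_mollify_indicator (hΩ : MeasurableSet Ω) (h : HasWeakPartial Ω j u v)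
    (hu : LocallyIntegrable (Ω.indicator u)) (i : ℕ) {x : EuclideanSpace ℝ (Fin n)}
    (hx : Metric.closedBall x (shrinkingBump (EuclideanSpace ℝ (Fin n)) i).rOut ⊆ Ω) :
    fderiv ℝ (mollify i (Ω.indicator u)) x (EuclideanSpace.single j 1) =
      mollify i (Ω.indicator v) x := by
  have hindicator (f g : EuclideanSpace ℝ (Fin n) → ℝ) :
      ∫ y, Ω.indicator f y * g y = ∫ y in Ω, f y * g y := by
    simp_rw [← integral_indicator hΩ, indicator_mul_left]
  have hsupp : tsupport (fun y => mollifier i (x - y)) ⊆ Ω := fun y hy => hx <| by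
    have := tsupport_comp_subset_preimage (mollifier i) (f := fun y => x - y) (by fun_prop) hy
    rwa [mem_preimage, tsupport_mollifier, mem_closedBall_zero_iff, ← dist_eq_norm, dist_comm]
      at this
  have htest := h.2.2 (fun y => mollifier i (x - y))
    ((contDiff_mollifier i).comp (contDiff_const.sub contDiff_id))
    ((hasCompactSupport_mollifier i).comp_homeomorph (Homeomorph.subLeft x)) hsupp
  have hreflect (y e) : fderiv ℝ (fun y => mollifier i (x - y)) y e =
      -fderiv ℝ (mollifier i) (x - y) e := by
    have hdiff := (contDiff_mollifier i).differentiable (by simp) (x - y)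
    have hcomp := hdiff.hasFDerivAt.comp y ((hasFDerivAt_id y).const_sub x)
    change fderiv ℝ (mollifier i ∘ fun y => x - y) y e = _
    rw [hcomp.fderiv]
    simp
  simp_rw [hreflect, mul_neg] at htest
  rw [integral_neg, neg_inj] at htest
  rw [fderiv_mollify_apply i hu, hindicator, htest, ← hindicator]
  simp only [mollify, mul_comm]

lemma mollify_indicator_ball_eq {x y : EuclideanSpace ℝ (Fin n)} {r : ℝ}
    (h : ∀ j, HasWeakPartial (Metric.ball x r) j u 0)
    (hu : LocallyIntegrable ((Metric.ball x r).indicator u)) {i : ℕ}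
    (hi : (shrinkingBump (EuclideanSpace ℝ (Fin n)) i).rOut < r / 2)
    (hy : y ∈ Metric.ball x (r / 2)) :
    mollify i ((Metric.ball x r).indicator u) y = mollify i ((Metric.ball x r).indicator u) x := by
  refine Metric.isOpen_ball.is_const_of_fderiv_eq_zero (𝕜 := ℝ)
    (convex_ball x (r / 2)).isPreconnected
    ((contDiff_mollify i hu).differentiable (by simp)).differentiableOn (fun z hz => ?_) hy
    (Metric.mem_ball_self (dist_nonneg.trans_lt hy))
  have hz' : Metric.closedBall z (shrinkingBump (EuclideanSpace ℝ (Fin n)) i).rOut ⊆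
      Metric.ball x r :=
    Metric.closedBall_subset_ball' (by linarith [Metric.mem_ball.1 hz])
  refine ContinuousLinearMap.coe_injective
    ((EuclideanSpace.basisFun (Fin n) ℝ).toBasis.ext fun j => ?_)
  simpa [mollify] using (h j).fderiv_mollify_indicator measurableSet_ball hu i hz'

lemma exists_eventually_eq_const (hΩ : IsOpen Ω) (h : ∀ j, HasWeakPartial Ω j u 0)
    (hu : LocallyIntegrableOn u Ω volume) {x : EuclideanSpace ℝ (Fin n)} (hx : x ∈ Ω) :
    ∃ c, ∀ᶠ y in 𝓝 x ⊓ ae volume, u y = c := by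
  obtain ⟨r, hr, hrΩ⟩ := Metric.nhds_basis_closedBall.mem_iff.1 (hΩ.mem_nhds hx)
  set f := (Metric.ball x r).indicator u
  have hf : LocallyIntegrable f :=
    ((integrable_indicator_iff measurableSet_ball).2 <|
      (hu.integrableOn_compact_subset hrΩ (isCompact_closedBall x r)).mono_set
        Metric.ball_subset_closedBall).locallyIntegrable
  have hscale : ∀ᶠ i in atTop, (shrinkingBump (EuclideanSpace ℝ (Fin n)) i).rOut < r / 2 :=
    tendsto_shrinkingBump_rOut.eventually (gt_mem_nhds (half_pos hr))
  refine ⟨limUnder atTop fun i => mollify i f x, ?_⟩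
  filter_upwards [mem_inf_of_left (Metric.ball_mem_nhds x (half_pos hr)),
    mem_inf_of_right (ae_tendsto_mollify hf)] with y hy hlim
  have hfy : f y = u y := indicator_of_mem (Metric.ball_subset_ball (half_le_self hr.le) hy) u
  rw [hfy] at hlim
  refine (Tendsto.limUnder_eq (hlim.congr' ?_)).symm
  filter_upwards [hscale] with i hi
  exact mollify_indicator_ball_eq
    (fun j => (h j).mono (Metric.ball_subset_closedBall.trans hrΩ)) hf hi hy

lemma exists_ae_eq_const (hΩ : IsOpen Ω) (hconn : IsConnected Ω)
    (h : ∀ j, HasWeakPartial Ω j u 0) : ∃ c, ∀ᵐ x ∂volume.restrict Ω, u x = c := by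
  rcases n with _ | n
  · exact ⟨u 0, Eventually.of_forall fun x => congr_arg u (Subsingleton.elim x 0)⟩
  · exact exists_ae_restrict_eq_const hΩ hconn fun _ hx =>
      exists_eventually_eq_const hΩ h (h 0).1 hx

end HasWeakPartial

end WeakDerivative

section Composition

variable {X ι : Type*} [MeasurableSpace X] {μ : Measure X} {f : ι → X → ℝ} {G : (ι → ℝ) → ℝ}

lemma exists_forall_norm_comp_le {C : ι → ℝ} (hG : Continuous G) :
    ∃ M, ∀ y : ι → ℝ, (∀ i, ‖y i‖ ≤ C i) → ‖G y‖ ≤ M := by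
  obtain ⟨M, hM⟩ := (isCompact_univ_pi fun i => isCompact_Icc (a := -C i) (b := C i))
    |>.exists_bound_of_continuousOn hG.continuousOn
  exact ⟨M, fun y hy => hM y fun i _ => abs_le.1 (hy i)⟩

lemma aestronglyMeasurable_comp [Finite ι] (hf : ∀ i, AEStronglyMeasurable (f i) μ)
    (hG : Continuous G) : AEStronglyMeasurable (fun x => G fun i => f i x) μ := by
  have := Fintype.ofFinite ι
  exact hG.comp_aestronglyMeasurable
    (aemeasurable_pi_lambda _ fun i => (hf i).aemeasurable).aestronglyMeasurable

lemma memLp_top_comp [Finite ι] (hf : ∀ i, MemLp (f i) ⊤ μ) (hG : Continuous G) :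
    MemLp (fun x => G fun i => f i x) ⊤ μ := by
  obtain ⟨M, hM⟩ := exists_forall_norm_comp_le (C := fun i => lpNorm (f i) ⊤ μ) hG
  refine memLp_top_of_bound (aestronglyMeasurable_comp (fun i => (hf i).1) hG) M ?_
  filter_upwards [ae_all_iff.2 fun i => ae_le_lpNorm_exponent_top (hf i)] with x hx
  exact hM _ hx

lemma locallyIntegrableOn_mul_of_memLp_top [TopologicalSpace X] {Ω : Set X} {f g : X → ℝ}
    (hg : MemLp g ⊤ (μ.restrict Ω)) (hf : LocallyIntegrableOn f Ω μ) :
    LocallyIntegrableOn (fun x => g x * f x) Ω μ := fun x hx => by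
  obtain ⟨t, ht, hft⟩ := hf x hx
  refine ⟨t ∩ Ω, inter_mem ht self_mem_nhdsWithin, ?_⟩
  have hgt : MemLp g ⊤ (μ.restrict (t ∩ Ω)) := hg.mono_measure (Measure.restrict_mono_set _
    inter_subset_right)
  exact hgt.integrable_mul (memLp_one_iff_integrable.2 (hft.mono_set inter_subset_left))

end Composition

section ChainRule

lemma sum_clm_apply_single_mul {ι : Type*} [Fintype ι] [DecidableEq ι] (L : (ι → ℝ) →L[ℝ] ℝ)
    (v : ι → ℝ) : ∑ i, L (Pi.single i 1) * v i = L v := by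
  conv_rhs => rw [pi_eq_sum_univ' v, map_sum]
  simp only [map_smul, smul_eq_mul, mul_comm]

lemma integral_clm_apply_mul {X ι : Type*} [MeasurableSpace X] {μ : Measure X} [Fintype ι]
    [DecidableEq ι] {L : X → (ι → ℝ) →L[ℝ] ℝ} {d : ι → X → ℝ} {φ : X → ℝ}
    (h : ∀ i, Integrable (fun x => L x (Pi.single i 1) * (φ x * d i x)) μ) :
    ∫ x, L x (fun i => d i x) * φ x ∂μ =
      ∑ i, ∫ x, L x (Pi.single i 1) * (φ x * d i x) ∂μ := by
  rw [← integral_finsetSum _ fun i _ => h i]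
  refine integral_congr_ae (Eventually.of_forall fun x => ?_)
  simp only [← sum_clm_apply_single_mul (L x) fun i => d i x, Finset.sum_mul, mul_assoc,
    mul_comm (φ x)]

lemma locallyIntegrableOn_clm_apply {X ι : Type*} [TopologicalSpace X] [MeasurableSpace X]
    {μ : Measure X} [Finite ι] [DecidableEq ι] {Ω : Set X} {L : X → (ι → ℝ) →L[ℝ] ℝ}
    {d : ι → X → ℝ} (hL : ∀ i, MemLp (fun x => L x (Pi.single i 1)) ⊤ (μ.restrict Ω))
    (hd : ∀ i, LocallyIntegrableOn (d i) Ω μ) :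
    LocallyIntegrableOn (fun x => L x fun i => d i x) Ω μ := by
  have := Fintype.ofFinite ι
  have hsum : (fun x => L x fun i => d i x) = ∑ i, fun x => L x (Pi.single i 1) * d i x := by
    ext x
    rw [Finset.sum_apply, sum_clm_apply_single_mul (L x) fun i => d i x]
  rw [hsum]
  exact Finset.sum_induction _ (LocallyIntegrableOn · Ω μ) (fun _ _ => LocallyIntegrableOn.add)
    integrableOn_zero.locallyIntegrableOn fun i _ => locallyIntegrableOn_mul_of_memLp_top (hL i)
      (hd i)

lemma tendsto_integral_comp_mollify_mul {E ι : Type*} [NormedAddCommGroup E]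
    [InnerProductSpace ℝ E] [FiniteDimensional ℝ E] [MeasurableSpace E] [BorelSpace E] [Finite ι]
    {f : ι → E → ℝ} {g : E → ℝ} {F : ℕ → E → ℝ} {G : (ι → ℝ) → ℝ}
    (hf : ∀ i, MemLp (f i) ⊤) (hG : Continuous G) (hg : Integrable g)
    (hF : ∀ k, AEStronglyMeasurable (F k))
    (hFg : Tendsto (fun k => ∫⁻ x, ‖F k x - g x‖ₑ) atTop (𝓝 0)) :
    Tendsto (fun k => ∫ x, G (fun i => mollify k (f i) x) * F k x) atTop
      (𝓝 (∫ x, G (fun i => f i x) * g x)) := by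
  have hfloc (i) : LocallyIntegrable (f i) := (hf i).locallyIntegrable le_top
  obtain ⟨M, hM⟩ := exists_forall_norm_comp_le (C := fun i => lpNorm (f i) ⊤ volume) hG
  refine tendsto_integral_mul_of_tendsto_ae_of_tendsto_lintegral_enorm_sub hg hF hFg
    (fun k => ?_) (C := M) (fun k => Eventually.of_forall fun x => ?_) ?_
  · exact aestronglyMeasurable_comp
      (fun i => (contDiff_mollify k (hfloc i)).continuous.aestronglyMeasurable) hG
  · exact hM _ fun i => norm_mollify_le k (ae_le_lpNorm_exponent_top (hf i)) x
  · filter_upwards [ae_all_iff.2 fun i => ae_tendsto_mollify (hfloc i)] with x hx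
    exact (hG.tendsto _).comp (tendsto_pi_nhds.2 hx)

lemma fderiv_comp_pi_apply {E ι : Type*} [NormedAddCommGroup E] [NormedSpace ℝ E] [Finite ι]
    {f : ι → E → ℝ} {H : (ι → ℝ) → ℝ} {x : E} (hH : DifferentiableAt ℝ H fun i => f i x)
    (hf : ∀ i, DifferentiableAt ℝ (f i) x) (e : E) :
    fderiv ℝ (fun y => H fun i => f i y) x e =
      fderiv ℝ H (fun i => f i x) fun i => fderiv ℝ (f i) x e := by
  have := Fintype.ofFinite ι
  have hcomp := hH.hasFDerivAt.comp x (hasFDerivAt_pi.2 fun i => (hf i).hasFDerivAt)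
  change fderiv ℝ (H ∘ fun y i => f i y) x e = _
  rw [hcomp.fderiv]
  rfl

variable {n : ℕ} {ι : Type*} [Fintype ι] {j : Fin n}
  {u du : ι → EuclideanSpace ℝ (Fin n) → ℝ} {H : (ι → ℝ) → ℝ}
  {φ : EuclideanSpace ℝ (Fin n) → ℝ}

lemma integral_comp_mul_fderiv_of_contDiff [DecidableEq ι] (hH : ContDiff ℝ 1 H)
    (hu : ∀ i, ContDiff ℝ 1 (u i)) (hdu : ∀ i, Continuous (du i)) (hφ : ContDiff ℝ ∞ φ)
    (hφc : HasCompactSupport φ) (hpartial : ∀ i, ∀ x ∈ tsupport φ,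
      fderiv ℝ (u i) x (EuclideanSpace.single j 1) = du i x) :
    ∫ x, H (fun i => u i x) * fderiv ℝ φ x (EuclideanSpace.single j 1) =
      -∑ i, ∫ x, fderiv ℝ H (fun i => u i x) (Pi.single i 1) * (φ x * du i x) := by
  have huc : Continuous fun x i => u i x := continuous_pi fun i => (hu i).continuous
  have hcomp := (HasWeakPartial.of_contDiff (hH.comp (contDiff_pi.2 hu)) univ j).2.2 φ hφ hφc
    (subset_univ _)
  simp only [Measure.restrict_univ] at hcomp
  refine hcomp.trans (congr_arg _ ?_)
  have hint (i) : Integrable fun x =>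
      fderiv ℝ H (fun i => u i x) (Pi.single i 1) * (φ x * du i x) :=
    ((((hH.continuous_fderiv one_ne_zero).comp huc).clm_apply continuous_const).mul
      (hφ.continuous.mul (hdu i))).integrable_of_hasCompactSupport hφc.mul_right.mul_left
  rw [← integral_clm_apply_mul hint]
  refine integral_congr_ae (Eventually.of_forall fun x => ?_)
  by_cases hx : x ∈ tsupport φ
  · simp only [← hpartial _ x hx, ← fderiv_comp_pi_apply (hH.differentiable one_ne_zero _)
      (fun i => (hu i).differentiable one_ne_zero x)]
    rfl
  · simp only [image_eq_zero_of_notMem_tsupport hx, mul_zero]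

lemma integral_comp_mul_fderiv_of_fderiv_mollify (hH : ContDiff ℝ 1 H)
    (hu : ∀ i, MemLp (u i) ⊤) (hdu : ∀ i, Integrable (du i)) (hφ : ContDiff ℝ ∞ φ)
    (hφc : HasCompactSupport φ)
    (hmollify : ∀ᶠ k in atTop, ∀ i, ∀ x ∈ tsupport φ,
      fderiv ℝ (mollify k (u i)) x (EuclideanSpace.single j 1) = mollify k (du i) x) :
    ∫ x, H (fun i => u i x) * fderiv ℝ φ x (EuclideanSpace.single j 1) =
      - ∫ x, fderiv ℝ H (fun i => u i x) (fun i => du i x) * φ x := by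
  classical
  have huloc (i) : LocallyIntegrable (u i) := (hu i).locallyIntegrable le_top
  have hdφ := continuous_fderiv_apply_single (hφ.of_le (by simp)) j
  have hpartial (i) : Continuous fun y => fderiv ℝ H y (Pi.single i 1) :=
    (hH.continuous_fderiv one_ne_zero).clm_apply continuous_const
  have hlhs := tendsto_integral_comp_mollify_mul hu hH.continuous
    (hdφ.integrable_of_hasCompactSupport (hφc.fderiv_apply ℝ _))
    (fun _ => hdφ.aestronglyMeasurable) (by simp)
  have hφtop : MemLp φ ⊤ := hφ.continuous.memLp_of_hasCompactSupport hφc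
  have hφdu (i) : Integrable fun x => φ x * du i x :=
    hφtop.integrable_mul (memLp_one_iff_integrable.2 (hdu i))
  have hmollify_cont (k i) : Continuous (mollify k (du i)) :=
    (contDiff_mollify k (hdu i).locallyIntegrable).continuous
  have hrhs (i) := tendsto_integral_comp_mollify_mul (F := fun k x => φ x * mollify k (du i) x)
    hu (hpartial i) (hφdu i)
    (fun k => (hφ.continuous.mul (hmollify_cont k i)).aestronglyMeasurable)
    (by simpa only [← mul_sub, enorm_mul] using
      tendsto_lintegral_mul_mollify_sub hφtop (memLp_one_iff_integrable.2 (hdu i)))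
  rw [integral_clm_apply_mul fun i =>
    (memLp_top_comp hu (hpartial i)).integrable_mul (memLp_one_iff_integrable.2 (hφdu i))]
  refine tendsto_nhds_unique hlhs ((tendsto_finsetSum _ fun i _ => hrhs i).neg.congr' ?_)
  filter_upwards [hmollify] with k hk
  exact (integral_comp_mul_fderiv_of_contDiff hH (fun i => (contDiff_mollify k (huloc i)).of_le
    (by simp)) (hmollify_cont k) hφ hφc hk).symm

lemma HasWeakPartial.comp {Ω : Set (EuclideanSpace ℝ (Fin n))} (hΩ : IsOpen Ω)
    (h : ∀ i, HasWeakPartial Ω j (u i) (du i)) (hu : ∀ i, MemLp (u i) ⊤ (volume.restrict Ω))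
    (hH : ContDiff ℝ 1 H) :
    HasWeakPartial Ω j (fun x => H fun i => u i x)
      (fun x => fderiv ℝ H (fun i => u i x) fun i => du i x) := by
  classical
  have hpartial (i) : Continuous fun y => fderiv ℝ H y (Pi.single i 1) :=
    (hH.continuous_fderiv one_ne_zero).clm_apply continuous_const
  refine ⟨locallyIntegrableOn_of_locallyIntegrable_restrict
    ((memLp_top_comp hu hH.continuous).locallyIntegrable le_top), locallyIntegrableOn_clm_apply
      (fun i => memLp_top_comp hu (hpartial i)) fun i => (h i).2.1, fun φ hφ hφc hφΩ => ?_⟩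
  obtain ⟨Ω', hΩ', hφΩ', hΩ'Ω, hcompact⟩ :=
    exists_open_between_and_isCompact_closure hφc hΩ hφΩ
  have hsub : Ω' ⊆ Ω := subset_closure.trans hΩ'Ω
  have huΩ' (i) : MemLp (Ω'.indicator (u i)) ⊤ :=
    (memLp_indicator_iff_restrict hΩ'.measurableSet).2 ((hu i).mono_measure
      (Measure.restrict_mono_set _ hsub))
  have hduΩ' (i) : Integrable (Ω'.indicator (du i)) :=
    (integrable_indicator_iff hΩ'.measurableSet).2
      (((h i).2.1.integrableOn_compact_subset hΩ'Ω hcompact).mono_set subset_closure)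
  have hdφΩ' := (tsupport_fderiv_apply_subset ℝ (f := φ) (EuclideanSpace.single j 1)).trans hφΩ'
  have htest := integral_comp_mul_fderiv_of_fderiv_mollify (j := j) hH huΩ' hduΩ' hφ hφc ?_
  · rw [setIntegral_mul_of_tsupport_subset (hdφΩ'.trans hsub),
      setIntegral_mul_of_tsupport_subset (hφΩ'.trans hsub),
      ← setIntegral_mul_of_tsupport_subset hdφΩ', ← setIntegral_mul_of_tsupport_subset hφΩ']
    rw [← setIntegral_mul_of_tsupport_subset hdφΩ', ← setIntegral_mul_of_tsupport_subset hφΩ']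
      at htest
    convert htest using 1
    · exact setIntegral_congr_fun hΩ'.measurableSet fun x hx => by simp only [indicator_of_mem hx]
    · exact congr_arg _ (setIntegral_congr_fun hΩ'.measurableSet fun x hx => by
        simp only [indicator_of_mem hx])
  · filter_upwards [eventually_closedBall_shrinkingBump_subset hφc hΩ' hφΩ'] with k hk i x hx
    exact ((h i).mono hsub).fderiv_mollify_indicator hΩ'.measurableSet
      ((huΩ' i).locallyIntegrable le_top) k (hk x hx)

end ChainRule

section CurlFree

lemma mollify_eq_zero {E : Type*} [NormedAddCommGroup E] [InnerProductSpace ℝ E]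
    [FiniteDimensional ℝ E] [MeasurableSpace E] [BorelSpace E] {f : E → ℝ} {x : E} (i : ℕ)
    (hf : ∀ᵐ y, y ∈ Metric.closedBall x (shrinkingBump E i).rOut → f y = 0) :
    mollify i f x = 0 := by
  refine integral_eq_zero_of_ae ?_
  filter_upwards [hf] with y hy
  by_cases hxy : x - y ∈ tsupport (mollifier i : E → ℝ)
  · rw [tsupport_mollifier, mem_closedBall_zero_iff, ← dist_eq_norm, dist_comm] at hxy
    simp [hy hxy]
  · simp [image_eq_zero_of_notMem_tsupport hxy]

lemma tsupport_mollify_subset {E : Type*} [NormedAddCommGroup E] [InnerProductSpace ℝ E]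
    [FiniteDimensional ℝ E] [MeasurableSpace E] [BorelSpace E] {f : E → ℝ} {K U : Set E} {i : ℕ}
    (hf : ∀ᵐ y, y ∉ K → f y = 0)
    (hi : ∀ x ∈ K, Metric.closedBall x (shrinkingBump E i).rOut ⊆ U) :
    tsupport (mollify i f) ⊆ closure U := by
  refine closure_mono fun x hx => ?_
  by_contra hxU
  refine hx (mollify_eq_zero i ?_)
  filter_upwards [hf] with y hy hyx
  exact hy fun hyK => hxU (hi y hyK (Metric.mem_closedBall_comm.1 hyx))

variable {n : ℕ} {Ω K U : Set (EuclideanSpace ℝ (Fin n))} {j k : Fin n}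
  {u v w ψ dψ dψj dψk : EuclideanSpace ℝ (Fin n) → ℝ} {p q : ENNReal}

namespace HasWeakPartial

lemma ae_eq_zero_of_notMem (h : HasWeakPartial Ω j ψ dψ) (hΩ : IsOpen Ω) (hK : IsClosed K)
    (hψ : ∀ x ∉ K, ψ x = 0) : ∀ᵐ x, x ∉ K → Ω.indicator dψ x = 0 := by
  have hzero : HasWeakPartial (Ω \ K) j (fun _ => 0) dψ :=
    (h.mono sdiff_subset).congr ((ae_restrict_mem (hΩ.sdiff hK).measurableSet).mono
      fun x hx => hψ x hx.2) (ae_eq_refl _)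
  filter_upwards [(ae_restrict_iff' (hΩ.sdiff hK).measurableSet).1
    (hzero.ae_unique (hΩ.sdiff hK) (const 0 _ j))] with x hx hxK
  by_cases hxΩ : x ∈ Ω
  · rw [indicator_of_mem hxΩ, hx ⟨hxΩ, hxK⟩]
  · exact indicator_of_notMem hxΩ _

lemma fderiv_mollify_indicator_of_forall_notMem_eq_zero (h : HasWeakPartial Ω j ψ dψ)
    (hΩ : IsOpen Ω) (hK : IsClosed K) (hψ : ∀ x ∉ K, ψ x = 0)
    (hψint : LocallyIntegrable (Ω.indicator ψ)) {i : ℕ}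
    (hKU : ∀ x ∈ K, Metric.closedBall x (shrinkingBump (EuclideanSpace ℝ (Fin n)) i).rOut ⊆ U)
    (hUΩ : ∀ x ∈ closure U,
      Metric.closedBall x (shrinkingBump (EuclideanSpace ℝ (Fin n)) i).rOut ⊆ Ω)
    (x : EuclideanSpace ℝ (Fin n)) :
    fderiv ℝ (mollify i (Ω.indicator ψ)) x (EuclideanSpace.single j 1) =
      mollify i (Ω.indicator dψ) x := by
  by_cases hx : x ∈ closure U
  · exact h.fderiv_mollify_indicator hΩ.measurableSet hψint i (hUΩ x hx)
  · have hψK : ∀ᵐ y, y ∉ K → Ω.indicator ψ y = 0 := Eventually.of_forall fun y hy => by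
      simp [indicator, hψ y hy]
    have hmollify := tsupport_mollify_subset (h.ae_eq_zero_of_notMem hΩ hK hψ) hKU
    rw [image_eq_zero_of_notMem_tsupport fun hx' => hx (hmollify hx'),
      fderiv_of_notMem_tsupport ℝ fun hx' => hx (tsupport_mollify_subset hψK hKU hx'), zero_apply]

end HasWeakPartial

lemma tendsto_integral_mul_mollify_indicator [p.HolderConjugate q] (hΩ : MeasurableSet Ω)
    (hv : MemLp v p (volume.restrict Ω)) (hw : MemLp w q (volume.restrict Ω)) :
    Tendsto (fun i => ∫ x in Ω, v x * mollify i (Ω.indicator w) x) atTop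
      (𝓝 (∫ x in Ω, v x * w x)) := by
  have hlim := tendsto_integral_mul_mollify ((memLp_indicator_iff_restrict hΩ).2 hv)
    ((memLp_indicator_iff_restrict hΩ).2 hw)
  have hindicator (g : EuclideanSpace ℝ (Fin n) → ℝ) :
      ∫ x, Ω.indicator v x * g x = ∫ x in Ω, v x * g x := by
    simp_rw [← integral_indicator hΩ, indicator_mul_left]
  simp_rw [hindicator] at hlim
  refine hlim.trans_eq (congr_arg 𝓝 (setIntegral_congr_fun hΩ fun x hx => ?_))
  simp only [indicator_of_mem hx]

lemma HasWeakPartial.integral_mul_gradient_comm [p.HolderConjugate q] (hΩ : IsOpen Ω)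
    (hv : HasWeakPartial Ω j u v) (hw : HasWeakPartial Ω k u w)
    (hvp : MemLp v p (volume.restrict Ω)) (hwp : MemLp w p (volume.restrict Ω))
    (hψj : HasWeakPartial Ω j ψ dψj) (hψk : HasWeakPartial Ω k ψ dψk)
    (hψjq : MemLp dψj q (volume.restrict Ω)) (hψkq : MemLp dψk q (volume.restrict Ω))
    (hK : IsCompact K) (hKΩ : K ⊆ Ω) (hψ : ∀ x ∉ K, ψ x = 0) :
    ∫ x in Ω, v x * dψk x = ∫ x in Ω, w x * dψj x := by
  obtain ⟨U, hU, hKU, hUΩ, hUc⟩ := exists_open_between_and_isCompact_closure hK hΩ hKΩ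
  have hψK : ∀ᵐ y, y ∉ K → Ω.indicator ψ y = 0 := Eventually.of_forall fun y hy => by
    simp [indicator, hψ y hy]
  have hψint : LocallyIntegrable (Ω.indicator ψ) := by
    have hΩK : Ω.indicator ψ = K.indicator ψ := by
      ext x
      by_cases hx : x ∈ K
      · rw [indicator_of_mem (hKΩ hx), indicator_of_mem hx]
      · simp [indicator, hψ x hx]
    rw [hΩK]
    exact ((integrable_indicator_iff hK.measurableSet).2
      (hψj.1.integrableOn_compact_subset hKΩ hK)).locallyIntegrable
  refine tendsto_nhds_unique (tendsto_integral_mul_mollify_indicator hΩ.measurableSet hvp hψkq)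
    ((tendsto_integral_mul_mollify_indicator hΩ.measurableSet hwp hψjq).congr' ?_)
  filter_upwards [eventually_closedBall_shrinkingBump_subset hK hU hKU,
    eventually_closedBall_shrinkingBump_subset hUc hΩ hUΩ] with i hi hi'
  have hsupp : tsupport (mollify i (Ω.indicator ψ)) ⊆ closure U :=
    tsupport_mollify_subset hψK hi
  simp_rw [← hψj.fderiv_mollify_indicator_of_forall_notMem_eq_zero hΩ hK.isClosed hψ hψint hi hi',
    ← hψk.fderiv_mollify_indicator_of_forall_notMem_eq_zero hΩ hK.isClosed hψ hψint hi hi']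
  exact (hv.integral_mul_fderiv_comm hw (contDiff_mollify i hψint)
    (hUc.of_isClosed_subset (isClosed_tsupport _) hsupp) (hsupp.trans hUΩ)).symm

end CurlFree

section BoundedWeakGradient

variable {n : ℕ} {Ω : Set (EuclideanSpace ℝ (Fin n))} {q : ENNReal}
  {u v : EuclideanSpace ℝ (Fin n) → ℝ} {du dv : Fin n → EuclideanSpace ℝ (Fin n) → ℝ}

/-- `u ∈ L^∞(Ω)` has the weak gradient `du`, where `du j = ∂ⱼ u ∈ L^q(Ω)`. This is the class of
coefficients for which products and smooth functions obey the usual differentiation rules. -/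
structure HasBddWeakGradient (Ω : Set (EuclideanSpace ℝ (Fin n))) (q : ENNReal)
    (u : EuclideanSpace ℝ (Fin n) → ℝ) (du : Fin n → EuclideanSpace ℝ (Fin n) → ℝ) : Prop where
  memLp_top : MemLp u ⊤ (volume.restrict Ω)
  hasWeakPartial (j : Fin n) : HasWeakPartial Ω j u (du j)
  memLp_gradient (j : Fin n) : MemLp (du j) q (volume.restrict Ω)

namespace HasBddWeakGradient

lemma congr (h : HasBddWeakGradient Ω q u du) (huv : u =ᵐ[volume.restrict Ω] v)
    (hduv : ∀ j, du j =ᵐ[volume.restrict Ω] dv j) : HasBddWeakGradient Ω q v dv where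
  memLp_top := h.memLp_top.ae_eq huv
  hasWeakPartial j := (h.hasWeakPartial j).congr huv (hduv j)
  memLp_gradient j := (h.memLp_gradient j).ae_eq (hduv j)

lemma comp {ι : Type*} [Fintype ι] {u : ι → EuclideanSpace ℝ (Fin n) → ℝ}
    {du : ι → Fin n → EuclideanSpace ℝ (Fin n) → ℝ} {H : (ι → ℝ) → ℝ} (hΩ : IsOpen Ω)
    (h : ∀ i, HasBddWeakGradient Ω q (u i) (du i)) (hH : ContDiff ℝ 1 H) :
    HasBddWeakGradient Ω q (fun x => H fun i => u i x)
      (fun j x => fderiv ℝ H (fun i => u i x) fun i => du i j x) where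
  memLp_top := memLp_top_comp (fun i => (h i).memLp_top) hH.continuous
  hasWeakPartial j :=
    .comp hΩ (fun i => (h i).hasWeakPartial j) (fun i => (h i).memLp_top) hH
  memLp_gradient j := by
    classical
    have hpartial (i : ι) : MemLp (fun x => fderiv ℝ H (fun i => u i x) (Pi.single i 1)) ⊤
        (volume.restrict Ω) := memLp_top_comp (fun i => (h i).memLp_top)
      ((hH.continuous_fderiv one_ne_zero).clm_apply continuous_const)
    refine (memLp_finsetSum Finset.univ fun i _ =>
      ((h i).memLp_gradient j).mul (hpartial i)).ae_eq ?_
    exact Eventually.of_forall fun x => sum_clm_apply_single_mul _ _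

lemma of_hasCompactSupport (hu : ContDiff ℝ 1 u) (hc : HasCompactSupport u) :
    HasBddWeakGradient Ω q u fun j x => fderiv ℝ u x (EuclideanSpace.single j 1) where
  memLp_top := (hu.continuous.memLp_of_hasCompactSupport hc).restrict Ω
  hasWeakPartial := .of_contDiff hu Ω
  memLp_gradient j := ((continuous_fderiv_apply_single hu j).memLp_of_hasCompactSupport
    (hc.fderiv_apply ℝ _)).restrict Ω

lemma mul (hΩ : IsOpen Ω) (hu : HasBddWeakGradient Ω q u du) (hv : HasBddWeakGradient Ω q v dv) :
    HasBddWeakGradient Ω q (fun x => u x * v x) fun j x => u x * dv j x + du j x * v x := by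
  have hH : ContDiff ℝ 1 fun y : Fin 2 → ℝ => y 0 * y 1 := by fun_prop
  refine (comp (u := ![u, v]) (du := ![du, dv]) hΩ (Fin.forall_fin_two.2 ⟨hu, hv⟩) hH).congr
    (ae_eq_refl _) fun j => Eventually.of_forall fun x => ?_
  change fderiv ℝ (fun y : Fin 2 → ℝ => y 0 * y 1) _ _ = _
  rw [fderiv_fun_mul (differentiableAt_apply _ _) (differentiableAt_apply _ _)]
  simp [fderiv_apply, mul_comm]

lemma sum {ι : Type*} [Fintype ι] {u : ι → EuclideanSpace ℝ (Fin n) → ℝ}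
    {du : ι → Fin n → EuclideanSpace ℝ (Fin n) → ℝ} (hΩ : IsOpen Ω)
    (h : ∀ i, HasBddWeakGradient Ω q (u i) (du i)) :
    HasBddWeakGradient Ω q (fun x => ∑ i, u i x) fun j x => ∑ i, du i j x := by
  have hsum : ContDiff ℝ 1 (∑ i, ContinuousLinearMap.proj i : (ι → ℝ) →L[ℝ] ℝ) :=
    ContinuousLinearMap.contDiff _
  simpa [ContinuousLinearMap.fderiv] using comp hΩ h hsum

lemma matrix_mul {F G : EuclideanSpace ℝ (Fin n) → Matrix (Fin n) (Fin n) ℝ}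
    {dF dG : Fin n → EuclideanSpace ℝ (Fin n) → Matrix (Fin n) (Fin n) ℝ} (hΩ : IsOpen Ω)
    (hF : ∀ i j, HasBddWeakGradient Ω q (fun x => F x i j) fun k x => dF k x i j)
    (hG : ∀ i j, HasBddWeakGradient Ω q (fun x => G x i j) fun k x => dG k x i j) (i j : Fin n) :
    HasBddWeakGradient Ω q (fun x => (F x * G x) i j)
      fun k x => (F x * dG k x + dF k x * G x) i j := by
  simpa only [Matrix.add_apply, Matrix.mul_apply, Finset.sum_add_distrib]
    using sum hΩ fun l => (hF i l).mul hΩ (hG l j)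

end HasBddWeakGradient

section MatrixInverse

lemma exists_contDiff_eq_inv {c : ℝ} (hc : 0 < c) :
    ∃ g : ℝ → ℝ, ContDiff ℝ ∞ g ∧ ∀ t, c ≤ |t| → g t = t⁻¹ := by
  let χ : ContDiffBump (0 : ℝ) := ⟨c / 3, c / 2, by positivity, by linarith⟩
  refine ⟨fun t => (1 - χ t) * t⁻¹, contDiff_iff_contDiffAt.2 fun t => ?_, fun t ht => ?_⟩
  · rcases eq_or_ne t 0 with rfl | ht
    · refine contDiffAt_const (c := (0 : ℝ)) |>.congr_of_eventuallyEq ?_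
      filter_upwards [χ.eventuallyEq_one] with t ht
      simp [ht]
    · exact (contDiffAt_const.sub χ.contDiff.contDiffAt).mul (contDiffAt_inv ℝ ht)
  · have hχ : χ t = 0 := χ.zero_of_le_dist (by simpa [χ] using (half_le_self hc.le).trans ht)
    simp [hχ]

variable {X ι : Type*} [NormedAddCommGroup X] [NormedSpace ℝ X] [Fintype ι] [DecidableEq ι]
  {M : X → Matrix ι ι ℝ} {m : WithTop ℕ∞}

lemma contDiff_det (hM : ∀ i j, ContDiff ℝ m fun x => M x i j) :
    ContDiff ℝ m fun x => (M x).det := by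
  simp only [Matrix.det_apply]
  exact ContDiff.sum fun σ _ => (contDiff_prod fun i _ => hM _ i).const_smul _

lemma contDiff_adjugate (hM : ∀ i j, ContDiff ℝ m fun x => M x i j) (i j : ι) :
    ContDiff ℝ m fun x => (M x).adjugate i j := by
  simp only [Matrix.adjugate_apply]
  refine contDiff_det fun k l => ?_
  by_cases hk : k = j
  · simpa [hk] using contDiff_const
  · simpa [hk] using hM k l

lemma exists_contDiff_eq_matrix_inv {c : ℝ} (hc : 0 < c) (i j : ι) :
    ∃ H : (ι × ι → ℝ) → ℝ, ContDiff ℝ ∞ H ∧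
      ∀ A : Matrix ι ι ℝ, c ≤ |A.det| → H (fun b => A b.1 b.2) = A⁻¹ i j := by
  obtain ⟨g, hg, hginv⟩ := exists_contDiff_eq_inv hc
  have hentry (k l : ι) : ContDiff ℝ ∞ fun y : ι × ι → ℝ => Matrix.of (fun a b => y (a, b)) k l :=
    contDiff_apply ℝ ℝ (k, l)
  refine ⟨_, (hg.comp (contDiff_det hentry)).mul (contDiff_adjugate hentry i j), fun A hA => ?_⟩
  simp only [Function.comp_apply, Matrix.inv_def, Ring.inverse_eq_inv', Matrix.smul_apply,
    smul_eq_mul, ← hginv _ hA]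
  rfl

end MatrixInverse

lemma HasBddWeakGradient.matrix_inv {F : EuclideanSpace ℝ (Fin n) → Matrix (Fin n) (Fin n) ℝ}
    {dF : Fin n → EuclideanSpace ℝ (Fin n) → Matrix (Fin n) (Fin n) ℝ} {c : ℝ} (hΩ : IsOpen Ω)
    (hF : ∀ i j, HasBddWeakGradient Ω q (fun x => F x i j) fun k x => dF k x i j) (hc : 0 < c)
    (hdet : ∀ᵐ x ∂volume.restrict Ω, c ≤ |(F x).det|) (i j : Fin n) :
    HasBddWeakGradient Ω q (fun x => (F x)⁻¹ i j)
      fun k x => (-((F x)⁻¹ * dF k x * (F x)⁻¹)) i j := by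
  have hexists (i j) : ∃ dg, HasBddWeakGradient Ω q (fun x => (F x)⁻¹ i j) dg := by
    obtain ⟨H, hH, hHinv⟩ := exists_contDiff_eq_matrix_inv hc i j
    exact ⟨_, (comp hΩ (fun b : Fin n × Fin n => hF b.1 b.2) (hH.of_le (by simp))).congr
      (hdet.mono fun x hx => hHinv _ hx) fun k => ae_eq_refl _⟩
  choose dg hdg using hexists
  let dG (k : Fin n) (x : EuclideanSpace ℝ (Fin n)) : Matrix (Fin n) (Fin n) ℝ :=
    .of fun i j => dg i j k x
  have hunit : ∀ᵐ x ∂volume.restrict Ω, IsUnit (F x).det :=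
    hdet.mono fun x hx => (abs_pos.1 (hc.trans_le hx)).isUnit
  have hprod : ∀ᵐ x ∂volume.restrict Ω, ∀ k, (F x)⁻¹ * dF k x + dG k x * F x = 0 := by
    rw [ae_all_iff]
    intro k
    have hone (i j) : ∀ᵐ x ∂volume.restrict Ω,
        ((F x)⁻¹ * F x) i j = (1 : Matrix (Fin n) (Fin n) ℝ) i j :=
      hunit.mono fun x hx => by rw [Matrix.nonsing_inv_mul _ hx]
    have hentry (i j) := (((matrix_mul (dF := dG) hΩ hdg hF i j).hasWeakPartial k).congr
      (hone i j) (ae_eq_refl _)).ae_unique hΩ (.const _ Ω k)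
    filter_upwards [ae_all_iff.2 fun i => ae_all_iff.2 (hentry i)] with x hx
    exact Matrix.ext hx
  refine (hdg i j).congr (ae_eq_refl _) fun k => ?_
  filter_upwards [hunit, hprod] with x hx hx'
  have hdG : dG k x = -((F x)⁻¹ * dF k x * (F x)⁻¹) := by
    rw [← Matrix.mul_nonsing_inv_cancel_right _ (dG k x) hx, ← neg_eq_of_add_eq_zero_right (hx' k),
      Matrix.neg_mul]
  exact congr_fun₂ hdG i j

end BoundedWeakGradient

section ColumnDivergence

variable {n : ℕ} {φ : ℝ} {dφ w : Fin n → ℝ} {F G : Matrix (Fin n) (Fin n) ℝ}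
  {dF dG : Fin n → Matrix (Fin n) (Fin n) ℝ}

/-- The divergence `∑ₖ ∂ₖ(φ Gₖₘ)` of the `m`-th column of the matrix field `φ G`, computed from the
values `φ`, `G` at a point and the partial derivatives `dφ k = ∂ₖφ`, `dG k = ∂ₖG` there. -/
def colDiv (φ : ℝ) (dφ : Fin n → ℝ) (G : Matrix (Fin n) (Fin n) ℝ)
    (dG : Fin n → Matrix (Fin n) (Fin n) ℝ) (m : Fin n) : ℝ :=
  ∑ k, (φ * dG k k m + dφ k * G k m)

lemma sum_mul_gradient_mul_column (φ : ℝ) (dφ w : Fin n → ℝ) (G : Matrix (Fin n) (Fin n) ℝ)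
    (dG : Fin n → Matrix (Fin n) (Fin n) ℝ) (r m : Fin n) :
    ∑ j, ∑ k, w j * (φ * G k m * dG k j r + (φ * dG k k m + dφ k * G k m) * G j r) =
      (w ᵥ* G) r * colDiv φ dφ G dG m + φ * ∑ j, w j * ∑ k, G k m * dG k j r := by
  simp only [Matrix.vecMul, dotProduct, colDiv]
  rw [Finset.sum_mul_sum]
  simp only [Finset.mul_sum, ← Finset.sum_add_distrib]
  exact Finset.sum_congr rfl fun j _ => Finset.sum_congr rfl fun k _ => by ring

lemma sum_mul_gradient_mul_column_swap (φ : ℝ) (dφ w : Fin n → ℝ) (G : Matrix (Fin n) (Fin n) ℝ)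
    (dG : Fin n → Matrix (Fin n) (Fin n) ℝ) (r m : Fin n) :
    ∑ j, ∑ k, w k * (φ * G k m * dG j j r + (φ * dG j k m + dφ j * G k m) * G j r) =
      (w ᵥ* G) m * colDiv φ dφ G dG r + φ * ∑ j, w j * ∑ k, G k r * dG k j m := by
  rw [← sum_mul_gradient_mul_column, Finset.sum_comm]
  exact Finset.sum_congr rfl fun j _ => Finset.sum_congr rfl fun k _ => by ring

lemma sum_mul_curl_mul_column (hcomm : ∀ j r m, ∑ k, G k m * dG k j r = ∑ k, G k r * dG k j m)
    (φ : ℝ) (dφ w : Fin n → ℝ) (r m : Fin n) :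
    ∑ j, ∑ k, (w j * (φ * G k m * dG k j r + (φ * dG k k m + dφ k * G k m) * G j r) -
        w k * (φ * G k m * dG j j r + (φ * dG j k m + dφ j * G k m) * G j r)) =
      (w ᵥ* G) r * colDiv φ dφ G dG m - (w ᵥ* G) m * colDiv φ dφ G dG r := by
  simp only [Finset.sum_sub_distrib, sum_mul_gradient_mul_column, sum_mul_gradient_mul_column_swap,
    hcomm _ r m, add_sub_add_right_eq_sub]

lemma sum_mul_neg_mul_mul_comm (hdF : ∀ j k l, dF k l j = dF j l k) (j r m : Fin n) :
    ∑ k, G k m * (-(G * dF k * G)) j r = ∑ k, G k r * (-(G * dF k * G)) j m := by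
  simp only [Matrix.neg_apply, Matrix.mul_apply, mul_neg, Finset.sum_neg_distrib, Finset.sum_mul,
    Finset.mul_sum]
  rw [Finset.sum_comm]
  refine congr_arg _ (Finset.sum_congr rfl fun a _ => Finset.sum_congr rfl fun k _ =>
    Finset.sum_congr rfl fun l _ => ?_)
  rw [hdF a k]
  ring

lemma sum_colDiv_mul_column (hGF : G * F = 1) (hdGF : ∀ k, G * dF k + dG k * F = 0) (φ : ℝ)
    (dφ : Fin n → ℝ) (s : Fin n) :
    ∑ m, colDiv (φ * F m s) (fun k => φ * dF k m s + dφ k * F m s) G dG m = dφ s := by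
  have hentry (k : Fin n) : ∑ m, (G k m * dF k m s + dG k k m * F m s) = 0 := by
    simpa only [Matrix.add_apply, Matrix.mul_apply, ← Finset.sum_add_distrib, Matrix.zero_apply]
      using congr_fun₂ (hdGF k) k s
  calc ∑ m, colDiv (φ * F m s) (fun k => φ * dF k m s + dφ k * F m s) G dG m
      = ∑ k, (φ * ∑ m, (G k m * dF k m s + dG k k m * F m s) + dφ k * (G * F) k s) := by
        simp only [colDiv, Matrix.mul_apply, Finset.mul_sum, ← Finset.sum_add_distrib]
        rw [Finset.sum_comm]
        exact Finset.sum_congr rfl fun k _ => Finset.sum_congr rfl fun m _ => by ring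
    _ = dφ s := by simp [hentry, hGF, Matrix.one_apply]

lemma eq_zero_of_symm_of_skew {ι : Type*} {t : ι → ι → ι → ℝ} (hsymm : ∀ i j k, t i j k = t i k j)
    (hskew : ∀ i j k, t i j k = -t j i k) (i j k : ι) : t i j k = 0 := by
  linarith [hskew i j k, hsymm j i k, hskew j k i, hsymm k j i, hskew k i j, hsymm i k j]

lemma transpose_mul_inv_eq_neg {W : Matrix (Fin n) (Fin n) ℝ} (hF : IsUnit F.det)
    (h : symPart (Wᵀ * F) = 0) : (W * F⁻¹)ᵀ = -(W * F⁻¹) := by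
  have hsym : Wᵀ * F + Fᵀ * W = 0 := by
    simpa using (smul_eq_zero.1 h).resolve_left (by norm_num)
  have hFinv : F⁻¹ᵀ * Fᵀ = 1 := by
    rw [← Matrix.transpose_mul, Matrix.mul_nonsing_inv _ hF, Matrix.transpose_one]
  rw [Matrix.transpose_mul, eq_neg_iff_add_eq_zero]
  calc F⁻¹ᵀ * Wᵀ + W * F⁻¹ = F⁻¹ᵀ * Wᵀ * (F * F⁻¹) + (F⁻¹ᵀ * Fᵀ) * (W * F⁻¹) := by
        rw [Matrix.mul_nonsing_inv _ hF, hFinv, mul_one, one_mul]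
    _ = F⁻¹ᵀ * (Wᵀ * F + Fᵀ * W) * F⁻¹ := by noncomm_ring
    _ = 0 := by rw [hsym, mul_zero, zero_mul]

end ColumnDivergence

section Rigidity

variable {n : ℕ} {Ω K : Set (EuclideanSpace ℝ (Fin n))} {p q : ENNReal}
  {u φ : EuclideanSpace ℝ (Fin n) → ℝ} {dφ : Fin n → EuclideanSpace ℝ (Fin n) → ℝ}
  {w : EuclideanSpace ℝ (Fin n) → Fin n → ℝ}
  {F G W : EuclideanSpace ℝ (Fin n) → Matrix (Fin n) (Fin n) ℝ}
  {dF dG : Fin n → EuclideanSpace ℝ (Fin n) → Matrix (Fin n) (Fin n) ℝ}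
  {Φ : EuclideanSpace ℝ (Fin n) → EuclideanSpace ℝ (Fin n)}

lemma memLp_vecMul {X : Type*} [MeasurableSpace X] {μ : Measure X} {w : X → Fin n → ℝ}
    {G : X → Matrix (Fin n) (Fin n) ℝ} (hw : ∀ j, MemLp (fun x => w x j) p μ)
    (hG : ∀ i j, MemLp (fun x => G x i j) ⊤ μ) (r : Fin n) :
    MemLp (fun x => (w x ᵥ* G x) r) p μ :=
  memLp_finsetSum Finset.univ fun j _ => (hG j r).mul' (hw j)

lemma memLp_colDiv (hφ : HasBddWeakGradient Ω q φ dφ)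
    (hG : ∀ i j, HasBddWeakGradient Ω q (fun x => G x i j) fun k x => dG k x i j) (m : Fin n) :
    MemLp (fun x => colDiv (φ x) (fun k => dφ k x) (G x) (fun k => dG k x) m) q
      (volume.restrict Ω) :=
  memLp_finsetSum _ fun k _ => (((hG k m).memLp_gradient k).mul hφ.memLp_top).add
    ((hG k m).memLp_top.mul' (hφ.memLp_gradient k))

/- With `Gₘ` the vector field given by the `m`-th column of `G`, the integrals are those of
`Gᵣu · div (φ Gₘ)` and `Gₘu · div (φ Gᵣ)`. Formally, both equal `-∫ φ GₘGᵣu`, since the fields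
commute by `hcomm`. -/
lemma integral_vecMul_mul_colDiv_comm [p.HolderConjugate q] (hΩ : IsOpen Ω)
    (hu : ∀ j, HasWeakPartial Ω j u fun x => w x j)
    (hw : ∀ j, MemLp (fun x => w x j) p (volume.restrict Ω))
    (hG : ∀ i j, HasBddWeakGradient Ω q (fun x => G x i j) fun k x => dG k x i j)
    (hcomm : ∀ᵐ x ∂volume.restrict Ω, ∀ j r m,
      ∑ k, G x k m * dG k x j r = ∑ k, G x k r * dG k x j m)
    (hφ : HasBddWeakGradient Ω q φ dφ) (hK : IsCompact K) (hKΩ : K ⊆ Ω)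
    (hφK : ∀ x ∉ K, φ x = 0) (r m : Fin n) :
    ∫ x in Ω, (w x ᵥ* G x) r * colDiv (φ x) (fun k => dφ k x) (G x) (fun k => dG k x) m =
      ∫ x in Ω, (w x ᵥ* G x) m * colDiv (φ x) (fun k => dφ k x) (G x) (fun k => dG k x) r := by
  have hψ (j k) := (hφ.mul hΩ (hG k m)).mul hΩ (hG j r)
  have hint (i j k l) := memLp_one_iff_integrable.1
    (((hψ j k).memLp_gradient l).mul' (r := 1) (hw i))
  have hcurl (j k) := (hu j).integral_mul_gradient_comm hΩ (hu k) (hw j) (hw k)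
    ((hψ j k).hasWeakPartial j) ((hψ j k).hasWeakPartial k) ((hψ j k).memLp_gradient j)
    ((hψ j k).memLp_gradient k) hK hKΩ fun x hx => by simp [hφK x hx]
  have hB := memLp_vecMul hw fun i j => (hG i j).memLp_top
  have hdiv := memLp_colDiv hφ hG
  have hBdiv (r m) := memLp_one_iff_integrable.1 ((hdiv m).mul' (r := 1) (hB r))
  rw [← sub_eq_zero, ← integral_sub (hBdiv r m) (hBdiv m r)]
  calc _ = ∫ x in Ω, ∑ j, ∑ k, (w x j * _ - w x k * _) := integral_congr_ae <| by
        filter_upwards [hcomm] with x hx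
        exact (sum_mul_curl_mul_column hx (φ x) _ (w x) r m).symm
    _ = ∑ j, ∑ k, ∫ x in Ω, (w x j * _ - w x k * _) :=
        (integral_finsetSum _ fun j _ => integrable_finsetSum _ fun k _ =>
          (hint j j k k).sub (hint k j k j)).trans <|
        Finset.sum_congr rfl fun j _ => integral_finsetSum _ fun k _ =>
          (hint j j k k).sub (hint k j k j)
    _ = 0 := Finset.sum_eq_zero fun j _ => Finset.sum_eq_zero fun k _ =>
        (integral_sub (hint j j k k) (hint k j k j)).trans (sub_eq_zero.2 (hcurl j k))

lemma integral_mul_colDiv_eq_zero [p.HolderConjugate q] (hΩ : IsOpen Ω)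
    (hW : IsWeakJacobian Ω Φ W) (hWp : ∀ i j, MemLp (fun x => W x i j) p (volume.restrict Ω))
    (hG : ∀ i j, HasBddWeakGradient Ω q (fun x => G x i j) fun k x => dG k x i j)
    (hcomm : ∀ᵐ x ∂volume.restrict Ω, ∀ j r m,
      ∑ k, G x k m * dG k x j r = ∑ k, G x k r * dG k x j m)
    (hskew : ∀ᵐ x ∂volume.restrict Ω, (W x * G x)ᵀ = -(W x * G x))
    (hφ : HasBddWeakGradient Ω q φ dφ) (hK : IsCompact K) (hKΩ : K ⊆ Ω)
    (hφK : ∀ x ∉ K, φ x = 0) (i r m : Fin n) :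
    ∫ x in Ω, (W x * G x) i r *
      colDiv (φ x) (fun k => dφ k x) (G x) (fun k => dG k x) m = 0 := by
  refine eq_zero_of_symm_of_skew (t := fun i r m => ∫ x in Ω, (W x * G x) i r *
    colDiv (φ x) (fun k => dφ k x) (G x) (fun k => dG k x) m) (fun i r m => ?_)
    (fun i r m => ?_) i r m
  · simp only [Matrix.mul_apply_eq_vecMul]
    exact integral_vecMul_mul_colDiv_comm hΩ (hW i) (hWp i) hG hcomm hφ hK hKΩ hφK r m
  · rw [← integral_neg]
    refine integral_congr_ae (hskew.mono fun x hx => ?_)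
    have hir : (W x * G x) i r = -(W x * G x) r i := congr_fun₂ hx r i
    simp only [hir, neg_mul]

lemma hasWeakPartial_mul_inv_zero [p.HolderConjugate q] (hΩ : IsOpen Ω)
    (hW : IsWeakJacobian Ω Φ W) (hWp : ∀ i j, MemLp (fun x => W x i j) p (volume.restrict Ω))
    (hF : ∀ i j, HasBddWeakGradient Ω q (fun x => F x i j) fun k x => dF k x i j)
    (hdF : ∀ᵐ x ∂volume.restrict Ω, ∀ j k l, dF k x l j = dF j x l k) {c : ℝ} (hc : 0 < c)
    (hdet : ∀ᵐ x ∂volume.restrict Ω, c ≤ |(F x).det|)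
    (hsym : ∀ᵐ x ∂volume.restrict Ω, symPart ((W x)ᵀ * F x) = 0) (s i r : Fin n) :
    HasWeakPartial Ω s (fun x => (W x * (F x)⁻¹) i r) 0 := by
  have hunit : ∀ᵐ x ∂volume.restrict Ω, IsUnit (F x).det :=
    hdet.mono fun x hx => (abs_pos.1 (hc.trans_le hx)).isUnit
  have hskew := (hunit.and hsym).mono fun x hx => transpose_mul_inv_eq_neg hx.1 hx.2
  have hcomm := hdF.mono fun x hx => sum_mul_neg_mul_mul_comm (G := (F x)⁻¹) hx
  have hG := HasBddWeakGradient.matrix_inv hΩ hF hc hdet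
  have hB : MemLp (fun x => (W x * (F x)⁻¹) i r) p (volume.restrict Ω) := by
    simpa only [Matrix.mul_apply_eq_vecMul] using memLp_vecMul (hWp i)
      (fun i j => (hG i j).memLp_top) r
  refine ⟨locallyIntegrableOn_of_locallyIntegrable_restrict
    (hB.locallyIntegrable (ENNReal.HolderConjugate.one_le p q)), locallyIntegrableOn_zero,
    fun φ hφ hφc hφΩ => ?_⟩
  have hφF (m) := (HasBddWeakGradient.of_hasCompactSupport (Ω := Ω) (q := q)
    (hφ.of_le (by simp)) hφc).mul hΩ (hF m s)
  have hφK (m x) (hx : x ∉ tsupport φ) : φ x * F x m s = 0 := by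
    rw [image_eq_zero_of_notMem_tsupport hx, zero_mul]
  have hzero (m) := integral_mul_colDiv_eq_zero hΩ hW hWp hG hcomm hskew (hφF m) hφc hφΩ (hφK m)
    i r m
  have hint (m) := memLp_one_iff_integrable.1 ((memLp_colDiv (hφF m) hG m).mul' (r := 1) hB)
  simp only [Pi.zero_apply, zero_mul, integral_zero, neg_zero]
  refine .trans ?_ ((integral_finsetSum Finset.univ fun m _ => hint m).trans
    (Finset.sum_eq_zero fun m _ => hzero m))
  refine integral_congr_ae (hunit.mono fun x hx => ?_)
  simp only [← Finset.mul_sum]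
  rw [sum_colDiv_mul_column (Matrix.nonsing_inv_mul _ hx) fun k => ?_]
  rw [Matrix.neg_mul, Matrix.nonsing_inv_mul_cancel_right _ _ hx, add_neg_cancel]

end Rigidity

section RigidDisplacement

variable {n m : ℕ} {Ω : Set (EuclideanSpace ℝ (Fin n))} {p q : ENNReal}

lemma IsWeakJacobian.exists_ae_eq_mulVec_add {l : ℕ}
    {Φ : EuclideanSpace ℝ (Fin n) → EuclideanSpace ℝ (Fin l)}
    {Ψ : EuclideanSpace ℝ (Fin n) → EuclideanSpace ℝ (Fin m)}
    {W : EuclideanSpace ℝ (Fin n) → Matrix (Fin l) (Fin n) ℝ}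
    {F : EuclideanSpace ℝ (Fin n) → Matrix (Fin m) (Fin n) ℝ} {A : Matrix (Fin l) (Fin m) ℝ}
    (hΩ : IsOpen Ω) (hconn : IsConnected Ω) (hW : IsWeakJacobian Ω Φ W)
    (hF : IsWeakJacobian Ω Ψ F) (hWF : ∀ᵐ x ∂volume.restrict Ω, W x = A * F x) :
    ∃ a : EuclideanSpace ℝ (Fin l),
      ∀ᵐ x ∂volume.restrict Ω, Φ x = WithLp.toLp 2 (A *ᵥ (Ψ x).ofLp) + a := by
  have hconst (i : Fin l) :
      ∃ c, ∀ᵐ x ∂volume.restrict Ω, Φ x i + ∑ r, -A i r * Ψ x r = c := by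
    have hgrad (j : Fin n) := (hW i j).add (.sum (fun r => (hF r j).const_mul (-A i r)) .univ)
    have hzero (j : Fin n) : HasWeakPartial Ω j (fun x => Φ x i + ∑ r, -A i r * Ψ x r) 0 :=
      (hgrad j).congr (ae_eq_refl _) <| hWF.mono fun x hx => by
        simp [hx, Matrix.mul_apply]
    exact HasWeakPartial.exists_ae_eq_const hΩ hconn hzero
  choose a ha using hconst
  refine ⟨WithLp.toLp 2 a, ?_⟩
  filter_upwards [ae_all_iff.2 ha] with x hx
  ext i
  simp [← hx i, Matrix.mulVec, dotProduct]

namespace MemSobolevVec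

variable {u : EuclideanSpace ℝ (Fin n) → EuclideanSpace ℝ (Fin m)}
  {G : EuclideanSpace ℝ (Fin n) → Matrix (Fin m) (Fin n) ℝ}

lemma memLp_weakJacobian (hu : MemSobolevVec Ω p 1 u) (hΩ : IsOpen Ω) (hG : IsWeakJacobian Ω u G)
    (i : Fin m) (j : Fin n) : MemLp (fun x => G x i j) p (volume.restrict Ω) := by
  obtain ⟨v, hv, hvp⟩ := (hu i).2 j
  exact hvp.ae_eq (hv.ae_unique hΩ (hG i j))

lemma exists_hasBddWeakGradient_weakJacobian (hu : MemSobolevVec Ω ⊤ 1 u)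
    (hu' : MemSobolevVec Ω p 2 u) (hΩ : IsOpen Ω) (hG : IsWeakJacobian Ω u G) :
    ∃ dG : Fin n → EuclideanSpace ℝ (Fin n) → Matrix (Fin m) (Fin n) ℝ,
      (∀ i j, HasBddWeakGradient Ω p (fun x => G x i j) fun k x => dG k x i j) ∧
        ∀ᵐ x ∂volume.restrict Ω, ∀ j k i, dG k x i j = dG j x i k := by
  have hexists (i j k) :
      ∃ d, HasWeakPartial Ω k (fun x => G x i j) d ∧ MemLp d p (volume.restrict Ω) := by
    obtain ⟨v, hv, -, hvk⟩ := (hu' i).2 j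
    obtain ⟨d, hd, hdp⟩ := hvk k
    exact ⟨d, hd.congr (hv.ae_unique hΩ (hG i j)) (ae_eq_refl _), hdp⟩
  choose d hd hdp using hexists
  refine ⟨fun k x => .of fun i j => d i j k x, fun i j =>
    ⟨hu.memLp_weakJacobian hΩ hG i j, hd i j, hdp i j⟩, ?_⟩
  simp only [ae_all_iff]
  exact fun j k i => ((hG i j).swap (hG i k) (hd i j k)).ae_unique hΩ (hd i k j)

end MemSobolevVec

theorem theorem3_general (hΩ : IsOpen Ω) (hconn : IsConnected Ω) [p.HolderConjugate q]
    {Φ Ψ : EuclideanSpace ℝ (Fin n) → EuclideanSpace ℝ (Fin n)} (hΦ : MemSobolevVec Ω p 1 Φ)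
    (hΨ₁ : MemSobolevVec Ω ⊤ 1 Ψ) (hΨ₂ : MemSobolevVec Ω q 2 Ψ)
    {gradΦ gradΨ : EuclideanSpace ℝ (Fin n) → Matrix (Fin n) (Fin n) ℝ}
    (hgradΦ : IsWeakJacobian Ω Φ gradΦ) (hgradΨ : IsWeakJacobian Ω Ψ gradΨ) {c : ℝ} (hc : 0 < c)
    (hdet : ∀ᵐ x ∂volume.restrict Ω, c ≤ |(gradΨ x).det|)
    (hsym : ∀ᵐ x ∂volume.restrict Ω, symPart ((gradΦ x)ᵀ * gradΨ x) = 0) :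
    ∃ A ∈ LieAlgebra.Orthogonal.so (Fin n) ℝ, ∃ a : EuclideanSpace ℝ (Fin n),
      ∀ᵐ x ∂volume.restrict Ω, Φ x = WithLp.toLp 2 (A *ᵥ (Ψ x).ofLp) + a := by
  obtain ⟨dF, hF, hdF⟩ := hΨ₁.exists_hasBddWeakGradient_weakJacobian hΨ₂ hΩ hgradΨ
  have hzero := hasWeakPartial_mul_inv_zero hΩ hgradΦ (hΦ.memLp_weakJacobian hΩ hgradΦ) hF hdF hc
    hdet hsym
  have hunit : ∀ᵐ x ∂volume.restrict Ω, IsUnit (gradΨ x).det :=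
    hdet.mono fun x hx => (abs_pos.1 (hc.trans_le hx)).isUnit
  choose A hA using fun i r => HasWeakPartial.exists_ae_eq_const hΩ hconn fun j => hzero j i r
  have hconst : ∀ᵐ x ∂volume.restrict Ω, gradΦ x * (gradΨ x)⁻¹ = .of A := by
    filter_upwards [ae_all_iff.2 fun i => ae_all_iff.2 (hA i)] with x hx using Matrix.ext hx
  have hne : (ae (volume.restrict Ω)).NeBot := ae_restrict_neBot.2
    (hΩ.measure_pos volume hconn.nonempty).ne'
  obtain ⟨x, hx, hxunit, hxsym⟩ := (hconst.and (hunit.and hsym)).exists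
  refine ⟨.of A, (LieAlgebra.Orthogonal.mem_so _ _ _).2 ?_,
    hgradΦ.exists_ae_eq_mulVec_add hΩ hconn hgradΨ ?_⟩
  · rw [← hx, transpose_mul_inv_eq_neg hxunit hxsym]
  · filter_upwards [hconst, hunit] with y hy hyunit
    rw [← hy, Matrix.nonsing_inv_mul_cancel_right _ _ hyunit]

end RigidDisplacement

theorem theorem3
    (Ω : Set (EuclideanSpace ℝ (Fin 3))) (hΩ : IsLipschitzDomain Ω)
    (p q : ℝ) (hp : 1 < p) (hq : 1 < q) (hpq : 1 / p + 1 / q = 1)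
    (Φ Ψ : EuclideanSpace ℝ (Fin 3) → EuclideanSpace ℝ (Fin 3))
    (hΦ : MemSobolevVec Ω (ENNReal.ofReal p) 1 Φ)
    (hΨ₁ : MemSobolevVec Ω ⊤ 1 Ψ)
    (hΨ₂ : MemSobolevVec Ω (ENNReal.ofReal q) 2 Ψ)
    (gradΦ gradΨ : EuclideanSpace ℝ (Fin 3) → Matrix (Fin 3) (Fin 3) ℝ)
    (hgradΦ : IsWeakJacobian Ω Φ gradΦ) (hgradΨ : IsWeakJacobian Ω Ψ gradΨ)
    (c : ℝ) (hc : 0 < c)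
    (hdet : ∀ᵐ x ∂(volume.restrict Ω), c ≤ (gradΨ x).det)
    (hsym : ∀ᵐ x ∂(volume.restrict Ω), symPart ((gradΦ x)ᵀ * gradΨ x) = 0) :
    ∃ A ∈ LieAlgebra.Orthogonal.so (Fin 3) ℝ, ∃ a : EuclideanSpace ℝ (Fin 3),
      ∀ᵐ x ∂(volume.restrict Ω), Φ x = WithLp.toLp 2 (A *ᵥ (Ψ x).ofLp) + a := by
  have := (Real.holderConjugate_iff.2 ⟨hp, by simpa using hpq⟩).ennrealOfReal
  exact theorem3_general hΩ.1 hΩ.2.1 hΦ hΨ₁ hΨ₂ hgradΦ hgradΨ hc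
    (hdet.mono fun x hx => hx.trans (le_abs_self _)) hsym
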